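/- Let $a,b,c\in\mathbb R$ satisfy ($c=0$ and $a\ne b$) or ($c>0$ and $a<b$). Put $Q(x)=ax(x-1)+bx+c$, let $\nu_0$ be the largest real root of $Q$ (with $\max\{0,\nu_0\}:=0$ if $Q$ has no real root), and let $\nu\ge\max\{0,\nu_0\}$ with $Q(\nu)\neq 0$. Let $J_\nu$ be the Bessel function of the first kind, $N_\nu(z)=az^2J_\nu''(z)+bzJ_\nu'(z)+cJ_\nu(z)$, and $$f_\nu(z)=\Big[\tfrac{2^\nu\Gamma(\nu+1)}{Q(\nu)}N_\nu(z)\Big]^{1/\nu}\ (\nu\ne0),\qquad g_\nu(z)=\tfrac{2^\nu\Gamma(\nu+1)}{Q(\nu)}z^{1-\nu}N_\nu(z),\qquad h_\nu(z)=\tfrac{2^\nu\Gamma(\nu+1)}{Q(\nu)}z^{1-\nu/2}N_\nu(\sqrt z),$$ on the analytic branches vanishing at $0$ with derivative $1$ there. Let $\varphi$ be analytic and univalent on the unit disk $\mathbb D$ with $\operatorname{Re}\varphi>0$, $\varphi'(0)>0$, and $\varphi(\mathbb D)$ starlike with respect to $\varphi(0)=1$ and symmetric about the real axis. Let $\beta$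 be the radius of the largest disk $\{w:|w-1|<\beta\}\subseteq\varphi(\mathbb D)$, and suppose that $\varphi(-1)=1-\beta$, where $\varphi(-1)=\lim_{x\to-1^+}\varphi(x)$. For a function $f$ analytic near $0$ with $f(0)=0$, $f'(0)=1$, its $\mathcal C(\varphi)$-radius is $$\sup\Big\{r>0:\ 1+\frac{zf''(z)}{f'(z)}\in\varphi(\mathbb D)\ \text{ for all } |z|<r\Big\}.$$ Let $\lambda_{\nu,1}$ be the smallest positive zero of $N_\nu$ (it exists). Then: (a) if $\nu\neq0$, the $\mathcal C(\varphi)$-radius of $f_\nu$ is the smallest positive root of $rf_\nu''(r)+\beta f_\nu'(r)=0$, and it lies in $(0,\lambda_{\nu,1})$; (b) the $\mathcal C(\varphi)$-radius of $g_\nu$ is the smallest positive root of $rg_\nu''(r)+\beta g_\nu'(r)=0$, and it lies in $(0,\lambda_{\nu,1})$; (c) the $\mathcal C(\varphi)$-radius of $h_\nu$ is the smallest positive root of $rh_\nu''(r)+\beta h_\nu'(r)=0$, and it lies in $(0,\lambda_{\nu,1}^2)$. -/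

import Mathlib

open Set Filter Topology Metric

noncomputable section

namespace MaMindaBessel

/-- The Bessel function of the first kind
`J_ν(z) = ∑ (-1)ⁿ / (n! Γ(n+ν+1)) (z/2)^(2n+ν)` (principal branch of the power). -/
def besselJ (ν : ℝ) (z : ℂ) : ℂ :=
  ∑' n : ℕ, (((-1) ^ n / (n.factorial * Real.Gamma (n + ν + 1)) : ℝ) : ℂ) *
    (z / 2) ^ (2 * (n : ℂ) + (ν : ℂ))

/-- `N_ν(z) = a z² J_ν''(z) + b z J_ν'(z) + c J_ν(z)`. -/
def besselN (a b c ν : ℝ) (z : ℂ) : ℂ :=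
  a * z ^ 2 * deriv (deriv (besselJ ν)) z + b * z * deriv (besselJ ν) z + c * besselJ ν z

/-- The quadratic `Q(x) = a x (x - 1) + b x + c`. -/
def Q (a b c x : ℝ) : ℝ := a * x * (x - 1) + b * x + c

/-- The entire function `E` for which
`2^ν Γ(ν+1) / Q(ν) * N_ν(z) = z^ν * E(z²)` on the slit plane; see `besselN_eq`. -/
def E (a b c ν : ℝ) (w : ℂ) : ℂ :=
  ∑' n : ℕ, (((-1) ^ n * Q a b c (2 * n + ν) * Real.Gamma (ν + 1) /
    (Q a b c ν * (n.factorial * Real.Gamma (n + ν + 1))) : ℝ) : ℂ) * (w / 4) ^ n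

/-- The analytic branch of `log E(z²)` that vanishes at `z = 0`: the integral of the logarithmic
derivative of `ζ ↦ E(ζ²)` along the segment from `0` to `z`; see `exp_logE`. -/
def logE (a b c ν : ℝ) (z : ℂ) : ℂ :=
  ∫ t in (0 : ℝ)..1, z * logDeriv (fun ζ : ℂ => E a b c ν (ζ ^ 2)) (t * z)

/-- `f_ν(z) = [2^ν Γ(ν+1) / Q(ν) * N_ν(z)]^(1/ν)`, on the branch that is analytic near `0` with
`f_ν(0) = 0`, `f_ν'(0) = 1`; see `fFun_eq`. -/
def fFun (a b c ν : ℝ) (z : ℂ) : ℂ := z * Complex.exp (logE a b c ν z / ν)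

/-- `g_ν(z) = 2^ν Γ(ν+1) z^(1-ν) / Q(ν) * N_ν(z)`, as an entire function; see `gFun_eq`. -/
def gFun (a b c ν : ℝ) (z : ℂ) : ℂ := z * E a b c ν (z ^ 2)

/-- `h_ν(z) = 2^ν Γ(ν+1) z^(1-ν/2) / Q(ν) * N_ν(√z)`, as an entire function; see `hFun_eq`. -/
def hFun (a b c ν : ℝ) (z : ℂ) : ℂ := z * E a b c ν z

/-- A Ma-Minda function on the unit disk. -/
structure IsMaMinda (φ : ℂ → ℂ) : Prop where
  differentiableOn : DifferentiableOn ℂ φ (ball 0 1)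
  injOn : InjOn φ (ball 0 1)
  re_pos : ∀ z ∈ ball (0 : ℂ) 1, 0 < (φ z).re
  map_zero : φ 0 = 1
  deriv_re_pos : 0 < (deriv φ 0).re
  deriv_im : (deriv φ 0).im = 0
  starConvex : StarConvex ℝ 1 (φ '' ball 0 1)
  symm : ∀ w ∈ φ '' ball 0 1, (starRingEnd ℂ) w ∈ φ '' ball 0 1

/-- The radii `r > 0` such that `1 + z f''(z) / f'(z)` is defined and lies in `φ(𝔻)` for all
`|z| < r`. -/
def convexRadii (φ f : ℂ → ℂ) : Set ℝ :=
  {r | 0 < r ∧ ∀ z ∈ ball (0 : ℂ) r,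
    deriv f z ≠ 0 ∧ 1 + z * deriv (deriv f) z / deriv f z ∈ φ '' ball 0 1}

/-- `R` is the `𝒞(φ)`-radius of `f`: the (finite) supremum of `convexRadii φ f`. -/
def IsConvexRadius (φ f : ℂ → ℂ) (R : ℝ) : Prop :=
  (convexRadii φ f).Nonempty ∧ IsLUB (convexRadii φ f) R

/-! The formulas for `N_ν`, `f_ν`, `g_ν`, `h_ν`. -/

/-- The coefficients of `(z/2)^(-ν) J_ν(z)`. -/
def coeff (ν : ℝ) (n : ℕ) : ℝ := (-1) ^ n / (n.factorial * Real.Gamma (n + ν + 1))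

theorem gamma_le {ν : ℝ} (hν : 0 ≤ ν) (n : ℕ) :
    Real.Gamma (ν + 1) ≤ Real.Gamma (n + ν + 1) := by
  induction n with
  | zero => simp
  | succ n ih =>
    have h : ((n + 1 : ℕ) : ℝ) + ν + 1 = (n + ν + 1) + 1 := by push_cast; ring
    have hp : 0 < (n : ℝ) + ν + 1 := by positivity
    rw [h, Real.Gamma_add_one hp.ne']
    have := Real.Gamma_pos_of_pos hp
    nlinarith [Nat.cast_nonneg (α := ℝ) n]

theorem abs_coeff_le {ν : ℝ} (hν : 0 ≤ ν) (n : ℕ) :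
    |coeff ν n| ≤ (Real.Gamma (ν + 1))⁻¹ / n.factorial := by
  have h0 : 0 < Real.Gamma (ν + 1) := Real.Gamma_pos_of_pos (by positivity)
  have h1 := gamma_le hν n
  have h2 : 0 < Real.Gamma (n + ν + 1) := h0.trans_le h1
  have h3 : (0 : ℝ) < n.factorial := by positivity
  rw [coeff, abs_div, abs_pow, abs_neg, abs_one, one_pow, abs_of_pos (by positivity),
    one_div, mul_inv, div_eq_inv_mul]
  gcongr

/-- The summands of `(z/2)^(-ν) J_ν(z)`. -/
def term (ν : ℝ) (n : ℕ) (z : ℂ) : ℂ := (coeff ν n : ℂ) * (z / 2) ^ (2 * n)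

/-- Their derivatives. -/
def term1 (ν : ℝ) (n : ℕ) (z : ℂ) : ℂ := (coeff ν n : ℂ) * (n * (z / 2) ^ (2 * n - 1))

theorem hasDerivAt_term (ν : ℝ) (n : ℕ) (z : ℂ) : HasDerivAt (term ν n) (term1 ν n z) z := by
  have h := ((((hasDerivAt_id z).div_const 2).pow (2 * n)).const_mul (coeff ν n : ℂ))
  refine h.congr_deriv ?_
  simp only [term1, id]
  push_cast
  ring

theorem hasDerivAt_term1 (ν : ℝ) (n : ℕ) (z : ℂ) :
    HasDerivAt (term1 ν n)
      ((coeff ν n : ℂ) * (n * ((2 * n - 1 : ℕ) * (z / 2) ^ (2 * n - 1 - 1) * (1 / 2)))) z := by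
  have h := (((((hasDerivAt_id z).div_const 2).pow (2 * n - 1)).const_mul (n : ℂ)).const_mul
    (coeff ν n : ℂ))
  exact h.congr_deriv (by simp only [id])

theorem summable_bound (K R : ℝ) :
    Summable (fun n : ℕ => K / n.factorial * (2 ^ n * R ^ (2 * n))) := by
  refine ((Real.summable_pow_div_factorial (2 * R ^ 2)).mul_left K).congr fun n => ?_
  rw [mul_pow, ← pow_mul]
  ring

theorem norm_term_le {ν : ℝ} (hν : 0 ≤ ν) {R : ℝ} (n : ℕ) {z : ℂ} (hz : ‖z / 2‖ ≤ R) :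
    ‖term ν n z‖ ≤ (Real.Gamma (ν + 1))⁻¹ / n.factorial * (2 ^ n * R ^ (2 * n)) := by
  have h0 : 0 < Real.Gamma (ν + 1) := Real.Gamma_pos_of_pos (by positivity)
  rw [term, norm_mul, norm_pow, Complex.norm_real, Real.norm_eq_abs]
  have h1 : ‖z / 2‖ ^ (2 * n) ≤ R ^ (2 * n) := by gcongr
  have h2 : (1 : ℝ) ≤ 2 ^ n := one_le_pow₀ (by norm_num)
  have h3 : 0 ≤ R ^ (2 * n) := by rw [pow_mul]; positivity
  have h4 : 0 ≤ (Real.Gamma (ν + 1))⁻¹ / n.factorial := by positivity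
  refine mul_le_mul (abs_coeff_le hν n) ?_ (by positivity) h4
  nlinarith

theorem norm_term1_le {ν : ℝ} (hν : 0 ≤ ν) {R : ℝ} (hR : 1 ≤ R) (n : ℕ) {z : ℂ}
    (hz : ‖z / 2‖ ≤ R) :
    ‖term1 ν n z‖ ≤ (Real.Gamma (ν + 1))⁻¹ / n.factorial * (2 ^ n * R ^ (2 * n)) := by
  have h0 : 0 < Real.Gamma (ν + 1) := Real.Gamma_pos_of_pos (by positivity)
  rw [term1, norm_mul, norm_mul, norm_pow, Complex.norm_real, Real.norm_eq_abs,
    Complex.norm_natCast]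
  have h1 : ‖z / 2‖ ^ (2 * n - 1) ≤ R ^ (2 * n) :=
    (pow_le_pow_left₀ (norm_nonneg _) hz _).trans (pow_le_pow_right₀ hR (Nat.sub_le _ _))
  have h2 : (n : ℝ) ≤ 2 ^ n := by exact_mod_cast n.lt_two_pow_self.le
  have h3 : 0 ≤ R ^ (2 * n) := by positivity
  have h4 : 0 ≤ (Real.Gamma (ν + 1))⁻¹ / n.factorial := by positivity
  exact mul_le_mul (abs_coeff_le hν n)
    (mul_le_mul h2 h1 (by positivity) (by positivity)) (by positivity) h4

/-- `(z/2)^(-ν) J_ν(z)`. -/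
def base (ν : ℝ) (z : ℂ) : ℂ := ∑' n, term ν n z

theorem ball_bound (z : ℂ) : ∃ R : ℝ, 1 ≤ R ∧ z ∈ ball (0 : ℂ) (2 * R) ∧
    ∀ w ∈ ball (0 : ℂ) (2 * R), ‖w / 2‖ ≤ R := by
  refine ⟨‖z‖ + 1, by linarith [norm_nonneg z], ?_, fun w hw => ?_⟩
  · rw [mem_ball_zero_iff]; linarith [norm_nonneg z]
  · rw [mem_ball_zero_iff] at hw
    rw [norm_div, Complex.norm_ofNat]
    linarith

theorem hasSum_base {ν : ℝ} (hν : 0 ≤ ν) (z : ℂ) :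
    HasSum (fun n => term ν n z) (base ν z) := by
  obtain ⟨R, -, hz, hR⟩ := ball_bound z
  exact (Summable.of_norm_bounded (summable_bound _ R)
    fun n => norm_term_le hν n (hR z hz)).hasSum

theorem hasSum_base1 {ν : ℝ} (hν : 0 ≤ ν) (z : ℂ) :
    HasSum (fun n => term1 ν n z) (deriv (base ν) z) := by
  obtain ⟨R, -, hz, hR⟩ := ball_bound z
  have := Complex.hasSum_deriv_of_summable_norm (F := term ν) (summable_bound _ R)
    (fun n w _ => (hasDerivAt_term ν n w).differentiableAt.differentiableWithinAt) isOpen_ball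
    (fun n w hw => norm_term_le hν n (hR w hw)) hz
  exact this.congr_fun fun n => (hasDerivAt_term ν n z).deriv.symm

theorem differentiable_base {ν : ℝ} (hν : 0 ≤ ν) : Differentiable ℂ (base ν) := fun z => by
  obtain ⟨R, -, hz, hR⟩ := ball_bound z
  exact (Complex.differentiableOn_tsum_of_summable_norm (F := term ν) (summable_bound _ R)
    (fun n w _ => (hasDerivAt_term ν n w).differentiableAt.differentiableWithinAt) isOpen_ball
    (fun n w hw => norm_term_le hν n (hR w hw))).differentiableAt (isOpen_ball.mem_nhds hz)

theorem deriv_base {ν : ℝ} (hν : 0 ≤ ν) : deriv (base ν) = fun z => ∑' n, term1 ν n z :=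
  funext fun z => (hasSum_base1 hν z).tsum_eq.symm

theorem hasSum_base2 {ν : ℝ} (hν : 0 ≤ ν) (z : ℂ) :
    HasSum (fun n : ℕ => (coeff ν n : ℂ) *
      (n * ((2 * n - 1 : ℕ) * (z / 2) ^ (2 * n - 1 - 1) * (1 / 2)))) (deriv (deriv (base ν)) z) := by
  obtain ⟨R, h1, hz, hR⟩ := ball_bound z
  have := Complex.hasSum_deriv_of_summable_norm (F := term1 ν) (summable_bound _ R)
    (fun n w _ => (hasDerivAt_term1 ν n w).differentiableAt.differentiableWithinAt) isOpen_ball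
    (fun n w hw => norm_term1_le hν h1 n (hR w hw)) hz
  rw [deriv_base hν]
  exact this.congr_fun fun n => (hasDerivAt_term1 ν n z).deriv.symm

theorem hasSum_E {a b c ν : ℝ} (hν : 0 ≤ ν) (hQ : Q a b c ν ≠ 0) (z : ℂ) :
    HasSum (fun n : ℕ => (((-1) ^ n * Q a b c (2 * n + ν) * Real.Gamma (ν + 1) /
      (Q a b c ν * (n.factorial * Real.Gamma (n + ν + 1))) : ℝ) : ℂ) * (z ^ 2 / 4) ^ n)
    ((Real.Gamma (ν + 1) / Q a b c ν : ℂ) *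
      (a * (ν * (ν - 1) * base ν z + 2 * ν * z * deriv (base ν) z +
        z ^ 2 * deriv (deriv (base ν)) z) +
        b * (ν * base ν z + z * deriv (base ν) z) + c * base ν z)) := by
  have h0 := hasSum_base hν z
  have h1 := hasSum_base1 hν z
  have h2 := hasSum_base2 hν z
  refine (((((h0.mul_left ((ν : ℂ) * (ν - 1))).add (h1.mul_left (2 * ν * z))).add
    (h2.mul_left (z ^ 2))).mul_left (a : ℂ)).add (((h0.mul_left (ν : ℂ)).add
    (h1.mul_left z)).mul_left (b : ℂ)) |>.add (h0.mul_left (c : ℂ))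
    |>.mul_left (Real.Gamma (ν + 1) / Q a b c ν : ℂ)).congr_fun fun n => ?_
  have hQ' : (Q a b c ν : ℂ) ≠ 0 := by exact_mod_cast hQ
  have e1 : z * ((n : ℂ) * (z / 2) ^ (2 * n - 1)) = 2 * n * (z / 2) ^ (2 * n) := by
    rcases n with _ | n
    · simp
    · rw [show 2 * (n + 1) - 1 = 2 * n + 1 by omega, show 2 * (n + 1) = 2 * n + 1 + 1 by ring]
      ring
  have e2 : z ^ 2 * ((n : ℂ) * ((2 * n - 1 : ℕ) * (z / 2) ^ (2 * n - 1 - 1) * (1 / 2))) =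
      2 * n * (2 * n - 1) * (z / 2) ^ (2 * n) := by
    rcases n with _ | n
    · simp
    · rw [show 2 * (n + 1) - 1 = 2 * n + 1 by omega, show 2 * (n + 1) = 2 * n + 1 + 1 by ring]
      push_cast
      ring
  have e3 : (z ^ 2 / 4) ^ n = (z / 2) ^ (2 * n) := by
    rw [pow_mul]; congr 1; ring
  have e4 : (((-1) ^ n * Q a b c (2 * n + ν) * Real.Gamma (ν + 1) /
      (Q a b c ν * (n.factorial * Real.Gamma (n + ν + 1))) : ℝ) : ℂ) =
      Real.Gamma (ν + 1) / Q a b c ν * ((coeff ν n : ℂ) * Q a b c (2 * n + ν)) := by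
    rw [coeff]; push_cast; ring
  have e5 : (Q a b c (2 * n + ν) : ℂ) =
      a * (2 * n + ν) * (2 * n + ν - 1) + b * (2 * n + ν) + c := by
    simp only [Q]; push_cast; ring
  rw [e4, e3, e5]
  simp only [term, term1]
  linear_combination (-(Real.Gamma (ν + 1) / Q a b c ν : ℂ) * coeff ν n) *
    ((a * 2 * ν + b) * e1 + a * e2)

theorem E_sq {a b c ν : ℝ} (hν : 0 ≤ ν) (hQ : Q a b c ν ≠ 0) (z : ℂ) :
    E a b c ν (z ^ 2) = (Real.Gamma (ν + 1) / Q a b c ν : ℂ) *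
      (a * (ν * (ν - 1) * base ν z + 2 * ν * z * deriv (base ν) z +
        z ^ 2 * deriv (deriv (base ν)) z) +
        b * (ν * base ν z + z * deriv (base ν) z) + c * base ν z) :=
  (hasSum_E hν hQ z).tsum_eq

theorem half_mem_slitPlane {z : ℂ} (hz : z ∈ Complex.slitPlane) : z / 2 ∈ Complex.slitPlane := by
  rw [Complex.mem_slitPlane_iff] at *
  have h1 : (z / 2).re = z.re / 2 := by simp
  have h2 : (z / 2).im = z.im / 2 := by simp
  rw [h1, h2]
  rcases hz with h | h
  · exact Or.inl (by positivity)
  · exact Or.inr (by positivity)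

theorem besselJ_eq {ν : ℝ} {z : ℂ} (hz : z ∈ Complex.slitPlane) :
    besselJ ν z = (z / 2) ^ (ν : ℂ) * base ν z := by
  have h0 : z / 2 ≠ 0 := Complex.slitPlane_ne_zero (half_mem_slitPlane hz)
  rw [besselJ, base, ← tsum_mul_left]
  refine tsum_congr fun n => ?_
  rw [Complex.cpow_add _ _ h0, term, coeff]
  have : (z / 2) ^ (2 * (n : ℂ)) = (z / 2) ^ (2 * n) := by
    rw [← Complex.cpow_natCast]; push_cast; rfl
  rw [this]; ring

theorem hasDerivAt_pow {ν : ℝ} {z : ℂ} (hz : z ∈ Complex.slitPlane) :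
    HasDerivAt (fun w : ℂ => (w / 2) ^ (ν : ℂ)) (ν / z * (z / 2) ^ (ν : ℂ)) z := by
  have h0 : z / 2 ≠ 0 := Complex.slitPlane_ne_zero (half_mem_slitPlane hz)
  have hz0 : z ≠ 0 := Complex.slitPlane_ne_zero hz
  refine (((hasDerivAt_id z).div_const 2).cpow_const (c := (ν : ℂ))
    (half_mem_slitPlane hz)).congr_deriv ?_
  simp only [id]
  rw [Complex.cpow_sub _ _ h0, Complex.cpow_one]
  field_simp

/-- Power-series form of `N_ν` on the slit plane. -/
theorem besselN_eq {a b c ν : ℝ} (hν : 0 ≤ ν) (hQ : Q a b c ν ≠ 0) {z : ℂ}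
    (hz : z ∈ Complex.slitPlane) :
    ((2 ^ ν * Real.Gamma (ν + 1) / Q a b c ν : ℝ) : ℂ) * besselN a b c ν z =
      z ^ (ν : ℂ) * E a b c ν (z ^ 2) := by
  have hS := Complex.isOpen_slitPlane
  have hB := differentiable_base hν
  have hB' : Differentiable ℂ (deriv (base ν)) := fun w =>
    ((hB.analyticAt w).deriv).differentiableAt
  have d1 : ∀ w ∈ Complex.slitPlane, deriv (besselJ ν) w =
      (w / 2) ^ (ν : ℂ) * (ν / w * base ν w + deriv (base ν) w) := fun w hw => by
    have he : besselJ ν =ᶠ[𝓝 w] fun w => (w / 2) ^ (ν : ℂ) * base ν w :=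
      eventually_of_mem (hS.mem_nhds hw) fun u hu => besselJ_eq hu
    rw [he.deriv_eq]
    refine (((hasDerivAt_pow hw).mul (hB w).hasDerivAt).congr_deriv ?_).deriv
    ring
  have hz0 : z ≠ 0 := Complex.slitPlane_ne_zero hz
  have d2 : deriv (deriv (besselJ ν)) z = (z / 2) ^ (ν : ℂ) *
      (ν * (ν - 1) / z ^ 2 * base ν z + 2 * ν / z * deriv (base ν) z +
        deriv (deriv (base ν)) z) := by
    have he : deriv (besselJ ν) =ᶠ[𝓝 z] fun w =>
        (w / 2) ^ (ν : ℂ) * (ν / w * base ν w + deriv (base ν) w) :=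
      eventually_of_mem (hS.mem_nhds hz) fun u hu => d1 u hu
    have hd : HasDerivAt (fun w : ℂ => (ν : ℂ) / w) (-ν / z ^ 2) z := by
      simpa [div_eq_mul_inv] using (hasDerivAt_inv hz0).const_mul (ν : ℂ)
    rw [he.deriv_eq]
    refine (((hasDerivAt_pow hz).mul ((hd.mul (hB z).hasDerivAt).add
      (hB' z).hasDerivAt)).congr_deriv ?_).deriv
    simp only [Pi.add_apply, Pi.mul_apply]
    field_simp
    ring
  have hp : z ^ (ν : ℂ) = ((2 ^ ν : ℝ) : ℂ) * (z / 2) ^ (ν : ℂ) := by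
    rw [Complex.ofReal_cpow (by norm_num : (0 : ℝ) ≤ 2)]
    have h2 : (z / 2) = ((2⁻¹ : ℝ) : ℂ) * z := by push_cast; ring
    have h3 : z = ((2 : ℝ) : ℂ) * (z / 2) := by push_cast; ring
    have hh : z / 2 ≠ 0 := Complex.slitPlane_ne_zero (half_mem_slitPlane hz)
    have h2' : ((2 : ℝ) : ℂ) ≠ 0 := by norm_num
    rw [Complex.cpow_def_of_ne_zero hz0, Complex.cpow_def_of_ne_zero hh,
      Complex.cpow_def_of_ne_zero h2', ← Complex.exp_add]
    conv_lhs => rw [h3, Complex.log_ofReal_mul (by norm_num) hh, Complex.ofReal_log (by norm_num)]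
    ring_nf
  rw [besselN, d2, d1 z hz, besselJ_eq hz, E_sq hν hQ, hp]
  have hQ' : (Q a b c ν : ℂ) ≠ 0 := by exact_mod_cast hQ
  push_cast
  field_simp

theorem gFun_eq {a b c ν : ℝ} (hν : 0 ≤ ν) (hQ : Q a b c ν ≠ 0) {z : ℂ}
    (hz : z ∈ Complex.slitPlane) :
    gFun a b c ν z = ((2 ^ ν * Real.Gamma (ν + 1) / Q a b c ν : ℝ) : ℂ) *
      z ^ (1 - ν : ℂ) * besselN a b c ν z := by
  have hz0 : z ≠ 0 := Complex.slitPlane_ne_zero hz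
  have hp : z ^ (ν : ℂ) ≠ 0 := by simp [Complex.cpow_eq_zero_iff, hz0]
  rw [mul_right_comm, besselN_eq hν hQ hz, Complex.cpow_sub _ _ hz0, Complex.cpow_one, gFun]
  field_simp

theorem hFun_eq {a b c ν : ℝ} (hν : 0 ≤ ν) (hQ : Q a b c ν ≠ 0) {z : ℂ}
    (hz : z ∈ Complex.slitPlane) :
    hFun a b c ν z = ((2 ^ ν * Real.Gamma (ν + 1) / Q a b c ν : ℝ) : ℂ) *
      z ^ (1 - ν / 2 : ℂ) * besselN a b c ν (z ^ (1 / 2 : ℂ)) := by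
  have hz0 : z ≠ 0 := Complex.slitPlane_ne_zero hz
  have hπ := Real.pi_pos
  have h1 : z.arg < Real.pi :=
    lt_of_le_of_ne (Complex.arg_le_pi z) (Complex.slitPlane_arg_ne_pi hz)
  have h2 : -Real.pi < z.arg := Complex.neg_pi_lt_arg z
  have him : (Complex.log z * (1 / 2)).im = z.arg / 2 := by
    simp [Complex.mul_im, Complex.log_im, div_eq_mul_inv]
  have hsq : (z ^ (1 / 2 : ℂ)) ^ 2 = z := by
    simp
  have hmem : z ^ (1 / 2 : ℂ) ∈ Complex.slitPlane := by
    refine Or.inl ?_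
    rw [Complex.cpow_def_of_ne_zero hz0, Complex.exp_re, him]
    exact mul_pos (Real.exp_pos _) (Real.cos_pos_of_mem_Ioo ⟨by linarith, by linarith⟩)
  have hpow : (z ^ (1 / 2 : ℂ)) ^ (ν : ℂ) = z ^ (ν / 2 : ℂ) := by
    rw [← Complex.cpow_mul _ (by rw [him]; linarith) (by rw [him]; linarith)]
    congr 1; ring
  have hp : z ^ (ν / 2 : ℂ) ≠ 0 := by simp [Complex.cpow_eq_zero_iff, hz0]
  rw [mul_right_comm, besselN_eq hν hQ hmem, hsq, hpow, Complex.cpow_sub _ _ hz0,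
    Complex.cpow_one, hFun]
  field_simp

theorem differentiable_E {a b c ν : ℝ} (hν : 0 ≤ ν) (hQ : Q a b c ν ≠ 0) :
    Differentiable ℂ (fun z : ℂ => E a b c ν (z ^ 2)) := by
  have hB := differentiable_base hν
  have hB' : Differentiable ℂ (deriv (base ν)) := fun w =>
    ((hB.analyticAt w).deriv).differentiableAt
  have hB'' : Differentiable ℂ (deriv (deriv (base ν))) := fun w =>
    ((hB'.analyticAt w).deriv).differentiableAt
  rw [funext (E_sq (a := a) (b := b) (c := c) hν hQ)]
  fun_prop

theorem E_zero {a b c ν : ℝ} (hν : 0 ≤ ν) (hQ : Q a b c ν ≠ 0) : E a b c ν 0 = 1 := by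
  have h0 : Real.Gamma (ν + 1) ≠ 0 := (Real.Gamma_pos_of_pos (by positivity)).ne'
  rw [E, tsum_eq_single 0 fun n hn => by simp [hn]]
  simp
  exact ⟨hQ, h0⟩

/-- `logE` is an analytic logarithm of `E(z²)` on every disk without zeros of `E(z²)`. -/
theorem exp_logE {a b c ν : ℝ} (hν : 0 ≤ ν) (hQ : Q a b c ν ≠ 0) {ρ : ℝ}
    (h : ∀ z ∈ ball (0 : ℂ) ρ, E a b c ν (z ^ 2) ≠ 0) :
    DifferentiableOn ℂ (logE a b c ν) (ball 0 ρ) ∧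
      ∀ z ∈ ball (0 : ℂ) ρ, Complex.exp (logE a b c ν z) = E a b c ν (z ^ 2) := by
  set u : ℂ → ℂ := fun z => E a b c ν (z ^ 2) with hu
  have hd : Differentiable ℂ u := differentiable_E hν hQ
  have hd' : Differentiable ℂ (deriv u) := fun w =>
    ((hd.analyticAt w).deriv).differentiableAt
  have hl : DifferentiableOn ℂ (logDeriv u) (ball 0 ρ) :=
    hd'.differentiableOn.div hd.differentiableOn h
  obtain ⟨L, hL⟩ := hl.isExactOn_ball.with_val_at 0 0
  have hL0 : L 0 = 0 := hL.1
  have hL1 : ∀ z ∈ ball (0 : ℂ) ρ, HasDerivAt L (logDeriv u z) z := hL.2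
  have hseg : ∀ z ∈ ball (0 : ℂ) ρ, ∀ t ∈ uIcc (0 : ℝ) 1, (t : ℂ) * z ∈ ball (0 : ℂ) ρ := by
    intro z hz t ht
    rw [uIcc_of_le zero_le_one] at ht
    rw [mem_ball_zero_iff] at *
    rw [norm_mul, Complex.norm_real, Real.norm_eq_abs, abs_of_nonneg ht.1]
    nlinarith [ht.2, norm_nonneg z]
  have heq : ∀ z ∈ ball (0 : ℂ) ρ, logE a b c ν z = L z := by
    intro z hz
    have hder : ∀ t ∈ uIcc (0 : ℝ) 1,
        HasDerivAt (fun t : ℝ => L (t * z)) (z * logDeriv u (t * z)) t := by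
      intro t ht
      have h1 : HasDerivAt (fun s : ℂ => s * z) z (t : ℂ) := by
        simpa using (hasDerivAt_id (t : ℂ)).mul_const z
      have h2 := (HasDerivAt.comp (t : ℂ) (hL1 _ (hseg z hz t ht)) h1).comp_ofReal
      exact h2.congr_deriv (mul_comm _ _)
    have hc : ContinuousOn (fun t : ℝ => z * logDeriv u (t * z)) (uIcc 0 1) :=
      continuousOn_const.mul (hl.continuousOn.comp (by fun_prop) (hseg z hz))
    have := intervalIntegral.integral_eq_sub_of_hasDerivAt hder hc.intervalIntegrable
    rw [logE, this]
    simp [hL0]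
  refine ⟨fun z hz => ((hL1 z hz).differentiableAt.differentiableWithinAt).congr heq (heq z hz),
    fun z hz => ?_⟩
  rw [heq z hz]
  have hz0 : (0 : ℂ) ∈ ball (0 : ℂ) ρ := mem_ball_self (pos_of_mem_ball hz)
  have key : ∀ w ∈ ball (0 : ℂ) ρ, HasDerivAt (fun w => u w * Complex.exp (-L w)) 0 w := by
    intro w hw
    refine ((hd w).hasDerivAt.mul (hL1 w hw).neg.cexp).congr_deriv ?_
    have hw0 : u w ≠ 0 := h w hw
    rw [logDeriv_apply, Pi.neg_apply]
    field_simp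
    ring
  have hconst := isOpen_ball.is_const_of_deriv_eq_zero (convex_ball (0 : ℂ) ρ).isPreconnected
    (fun w hw => (key w hw).differentiableAt.differentiableWithinAt)
    (fun w hw => (key w hw).deriv) hz hz0
  have hu0 : u 0 = 1 := by simp [hu, E_zero hν hQ]
  simp only [hL0, hu0, neg_zero, Complex.exp_zero, mul_one] at hconst
  rw [Complex.exp_neg] at hconst
  field_simp at hconst
  exact hconst.symm

/-- On every disk without zeros of `E(z²)`, `fFun` is analytic, normalized, and a branch of
`[2^ν Γ(ν+1) / Q(ν) * N_ν(z)]^(1/ν)`. -/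
theorem fFun_eq {a b c ν : ℝ} (hν : 0 < ν) (hQ : Q a b c ν ≠ 0) {ρ : ℝ} (hρ : 0 < ρ)
    (h : ∀ z ∈ ball (0 : ℂ) ρ, E a b c ν (z ^ 2) ≠ 0) :
    DifferentiableOn ℂ (fFun a b c ν) (ball 0 ρ) ∧ fFun a b c ν 0 = 0 ∧
      deriv (fFun a b c ν) 0 = 1 ∧
      ∀ z ∈ ball (0 : ℂ) ρ, z ∈ Complex.slitPlane →
        ∃ w : ℂ, Complex.exp w = fFun a b c ν z ∧ Complex.exp (ν * w) =
          ((2 ^ ν * Real.Gamma (ν + 1) / Q a b c ν : ℝ) : ℂ) * besselN a b c ν z := by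
  obtain ⟨h1, h2⟩ := exp_logE hν.le hQ h
  have hν' : (ν : ℂ) ≠ 0 := by exact_mod_cast hν.ne'
  have hd : DifferentiableOn ℂ (fun z => Complex.exp (logE a b c ν z / ν)) (ball 0 ρ) :=
    (h1.div_const _).cexp
  refine ⟨differentiableOn_id.mul hd, by simp [fFun], ?_, fun z hz hs => ?_⟩
  · have h3 := (hasDerivAt_id (0 : ℂ)).mul
      (hd.differentiableAt (isOpen_ball.mem_nhds (mem_ball_self hρ))).hasDerivAt
    refine (h3.congr_deriv ?_).deriv
    simp [logE]
  · have hz0 : z ≠ 0 := Complex.slitPlane_ne_zero hs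
    refine ⟨Complex.log z + logE a b c ν z / ν, ?_, ?_⟩
    · rw [Complex.exp_add, Complex.exp_log hz0, fFun]
    · rw [besselN_eq hν.le hQ hs, ← h2 z hz, Complex.cpow_def_of_ne_zero hz0, ← Complex.exp_add]
      congr 1
      field_simp

end MaMindaBessel

/-! ### Formal power series: positivity of the negative logarithmic derivative. -/

namespace MaMindaBessel

open PowerSeries

/-! Everything rests on one fact: the power series of `-E'/E` has positive coefficients, bounded
below by a geometric sequence. It is proved formally, with no Hadamard product and no reality of
zeros. For the Bessel series, Bessel's equation turns `-J'/J` into the solution of a Riccati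
equation whose coefficient recursion preserves signs (`nonnegLog_besselSeries`). Then `E` arises
from that series by one or two operators `F ↦ X F' + (s - t X) F` with `s > 0`, `t ≥ 0`, and each of
them preserves positivity of `-F'/F` and creates the geometric bound (`NonnegLog.step`,
`geomLog_ECoeff`).

The geometric bound forces `E` to have a zero, and positivity puts a zero of least modulus, `Λ`, on
the positive axis (`exists_first_zero`); hence the smallest positive zero of `N_ν` is `√Λ`. On the
disk of radius `Λ`, `S(w) = -w E'(w)/E(w)` and `w S'(w)` are bounded in modulus by their values at
`|w|`, and `S` is unbounded along the axis (`isMajorized_of_hasSum`).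

All three functions have the form `z q(z)` with `z q'/q = -A S(z^p)`, where `(A, p)` is `(2/ν, 2)`,
`(2, 2)`, `(1, 1)`. Hence `|z f''/f'|` is at most `-r f''(r)/f'(r)` at `r = |z|`, as long as the
latter expression is controlled on the axis. The image point stays in the disk of radius `β` about
`1` up to the first root `R` of `r f'' + β f' = 0`, and at `z = R` it equals `1 - β`. As a boundary
value of an injective map, this point is not in `φ(𝔻)`, so `R` is the exact radius
(`exists_convexRadius`, `boundary_value_notMem`). -/

/-- `-F'/F` has nonnegative coefficients and a positive constant coefficient. -/
def NonnegLog (F : PowerSeries ℝ) : Prop :=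
  ∃ S : PowerSeries ℝ, derivative ℝ F = -(S * F) ∧ (∀ n, 0 ≤ PowerSeries.coeff n S) ∧ 0 < PowerSeries.coeff 0 S

/-- The coefficients of `-F'/F` are bounded below by a geometric sequence. -/
def GeomLog (F : PowerSeries ℝ) : Prop :=
  ∃ (S : PowerSeries ℝ) (v : ℝ), derivative ℝ F = -(S * F) ∧ 0 < v ∧
    ∀ n, v ^ (n + 1) ≤ PowerSeries.coeff n S

theorem GeomLog.nonnegLog {F : PowerSeries ℝ} (h : GeomLog F) : NonnegLog F := by
  obtain ⟨S, v, h1, hv, h2⟩ := h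
  exact ⟨S, h1, fun n => (by positivity : 0 ≤ v ^ (n + 1)).trans (h2 n),
    (by positivity : 0 < v ^ (0 + 1)).trans_le (h2 0)⟩

theorem GeomLog.const_mul {F : PowerSeries ℝ} (h : GeomLog F) (k : ℝ) : GeomLog (C k * F) := by
  obtain ⟨S, v, h1, hv, h2⟩ := h
  refine ⟨S, v, ?_, hv, h2⟩
  rw [Derivation.leibniz, derivative_C, h1]
  simp only [smul_eq_mul, mul_zero, add_zero]
  ring

/-- The inverse `W` satisfies `s W = 1 + X U W`, a recursion with nonnegative terms. Keeping only
the term with the constant coefficient of `U` gives `s w_{n+1} ≥ u_0 w_n`. This is where the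
geometric growth comes from. -/
theorem coeff_inv_ge {s : ℝ} (hs : 0 < s) {U : PowerSeries ℝ} (hU : ∀ n, 0 ≤ PowerSeries.coeff n U) (n : ℕ) :
    (PowerSeries.coeff 0 U) ^ n / s ^ (n + 1) ≤ PowerSeries.coeff n (C s - X * U)⁻¹ := by
  set W := (C s - X * U)⁻¹ with hW
  have hc : constantCoeff (C s - X * U) ≠ 0 := by simp [hs.ne']
  have h1 : (C s - X * U) * W = 1 := PowerSeries.mul_inv_cancel _ hc
  have h2 : C s * W = 1 + X * (U * W) := by rw [← h1]; ring
  have h0 : PowerSeries.coeff 0 W = 1 / s := by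
    have := congrArg (PowerSeries.coeff 0) h2
    rw [coeff_C_mul, map_add, coeff_zero_X_mul, coeff_zero_one, add_zero] at this
    field_simp
    linarith
  have hrec : ∀ n, s * PowerSeries.coeff (n + 1) W =
      ∑ p ∈ Finset.HasAntidiagonal.antidiagonal n, PowerSeries.coeff p.1 U * PowerSeries.coeff p.2 W := by
    intro n
    have := congrArg (PowerSeries.coeff (n + 1)) h2
    rwa [coeff_C_mul, map_add, coeff_succ_X_mul, coeff_mul, coeff_one, if_neg (by omega),
      zero_add] at this
  have hnn : ∀ n, 0 ≤ PowerSeries.coeff n W := by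
    intro n
    induction n using Nat.strong_induction_on with
    | _ n ih =>
      rcases n with _ | n
      · rw [h0]; positivity
      · have : 0 ≤ s * PowerSeries.coeff (n + 1) W := by
          rw [hrec]
          refine Finset.sum_nonneg fun p hp => mul_nonneg (hU _) (ih _ ?_)
          have := Finset.HasAntidiagonal.mem_antidiagonal.1 hp
          omega
        exact nonneg_of_mul_nonneg_right this hs
  induction n with
  | zero => rw [h0]; simp
  | succ n ih =>
    have h3 : PowerSeries.coeff 0 U * PowerSeries.coeff n W ≤ s * PowerSeries.coeff (n + 1) W := by
      rw [hrec]
      exact Finset.single_le_sum (f := fun p : ℕ × ℕ => PowerSeries.coeff p.1 U * PowerSeries.coeff p.2 W)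
        (fun p _ => mul_nonneg (hU _) (hnn _))
        (Finset.HasAntidiagonal.mem_antidiagonal.2 (by simp) : (0, n) ∈ Finset.HasAntidiagonal.antidiagonal n)
    have h4 := mul_le_mul_of_nonneg_left ih (hU 0)
    have h5 := h4.trans h3
    rw [div_le_iff₀ (by positivity)]
    rw [← mul_div_assoc, div_le_iff₀ (by positivity)] at h5
    calc PowerSeries.coeff 0 U ^ (n + 1) = PowerSeries.coeff 0 U * PowerSeries.coeff 0 U ^ n := by
          ring
      _ ≤ _ := h5
      _ = _ := by ring

/-- The operator `F ↦ X F' + (s - t X) F` turns nonnegative logarithmic derivatives into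
geometrically bounded ones. -/
theorem NonnegLog.step {F : PowerSeries ℝ} (h : NonnegLog F) {s t : ℝ} (hs : 0 < s) (ht : 0 ≤ t) :
    GeomLog (X * derivative ℝ F + (C s - C t * X) * F) := by
  obtain ⟨S, h1, h2, h3⟩ := h
  set U := S + C t with hU
  have hU0 : ∀ n, 0 ≤ PowerSeries.coeff n U := by
    intro n
    rw [hU, map_add, coeff_C]
    have := h2 n
    split_ifs <;> linarith
  have hU1 : 0 < PowerSeries.coeff 0 U := by
    rw [hU, map_add, coeff_C, if_pos rfl]; linarith
  set W := (C s - X * U)⁻¹ with hW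
  have hc : constantCoeff (C s - X * U) ≠ 0 := by simp [hs.ne']
  have hWinv : (C s - X * U) * W = 1 := PowerSeries.mul_inv_cancel _ hc
  -- Since `F' = -S F`, the operator is multiplication by `s - X U` with `U = S + t`. The new
  -- negative logarithmic derivative is therefore `S + (X U)' / (s - X U)`.
  have hF : X * derivative ℝ F + (C s - C t * X) * F = (C s - X * U) * F := by
    rw [h1, hU]; ring
  clear_value U
  have hWge := coeff_inv_ge hs hU0
  have hWnn : ∀ n, 0 ≤ PowerSeries.coeff n W := fun n =>
    (div_nonneg (pow_nonneg hU1.le _) (by positivity)).trans (hWge n)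
  have hV : ∀ n, 0 ≤ PowerSeries.coeff n (derivative ℝ (X * U)) := fun n => by
    rw [coeff_derivative, coeff_succ_X_mul]
    exact mul_nonneg (hU0 n) (by positivity)
  refine ⟨S + derivative ℝ (X * U) * W, PowerSeries.coeff 0 U / s, ?_, by positivity, fun n => ?_⟩
  · rw [hF, Derivation.leibniz, h1, map_sub, derivative_C]
    simp only [smul_eq_mul]
    linear_combination (derivative ℝ (X * U) * F) * hWinv
  · have h5 : PowerSeries.coeff 0 (derivative ℝ (X * U)) = PowerSeries.coeff 0 U := by
      rw [coeff_derivative, coeff_succ_X_mul]; simp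
    generalize derivative ℝ (X * U) = D at hV h5
    rw [map_add, coeff_mul]
    have h4 : PowerSeries.coeff 0 D * PowerSeries.coeff n W ≤
        ∑ p ∈ Finset.HasAntidiagonal.antidiagonal n,
          PowerSeries.coeff p.1 D * PowerSeries.coeff p.2 W :=
      Finset.single_le_sum
        (f := fun p : ℕ × ℕ => PowerSeries.coeff p.1 D * PowerSeries.coeff p.2 W)
        (fun p _ => mul_nonneg (hV _) (hWnn _))
        (Finset.HasAntidiagonal.mem_antidiagonal.2 (by simp) :
          (0, n) ∈ Finset.HasAntidiagonal.antidiagonal n)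
    rw [h5] at h4
    have h6 := mul_le_mul_of_nonneg_left (hWge n) hU1.le
    have h7 : (PowerSeries.coeff 0 U / s) ^ (n + 1) =
        PowerSeries.coeff 0 U * (PowerSeries.coeff 0 U ^ n / s ^ (n + 1)) := by
      rw [div_pow]; ring
    rw [h7]
    linarith [h2 n]

/-- The coefficients of `Γ(ν+1) (√w/2)^(-ν) J_ν(√w)` as a power series in `w`. -/
def besselCoeff (ν : ℝ) (n : ℕ) : ℝ :=
  (-1) ^ n * Real.Gamma (ν + 1) / (n.factorial * Real.Gamma (n + ν + 1)) / 4 ^ n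

theorem besselCoeff_zero {ν : ℝ} (hν : 0 ≤ ν) : besselCoeff ν 0 = 1 := by
  have h0 : Real.Gamma (ν + 1) ≠ 0 := (Real.Gamma_pos_of_pos (by positivity)).ne'
  simp [besselCoeff, h0]

theorem besselCoeff_succ {ν : ℝ} (hν : 0 ≤ ν) (n : ℕ) :
    4 * (n + 1) * (n + 1 + ν) * besselCoeff ν (n + 1) = -besselCoeff ν n := by
  have hp : 0 < (n : ℝ) + ν + 1 := by positivity
  have h : ((n + 1 : ℕ) : ℝ) + ν + 1 = (n + ν + 1) + 1 := by push_cast; ring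
  have hG := (Real.Gamma_pos_of_pos hp).ne'
  have hn : (n.factorial : ℝ) ≠ 0 := by positivity
  rw [besselCoeff, besselCoeff, h, Real.Gamma_add_one hp.ne', Nat.factorial_succ]
  push_cast
  have : (n : ℝ) + 1 ≠ 0 := by positivity
  field_simp
  ring

/-- The power series of `Γ(ν+1) (√w/2)^(-ν) J_ν(√w)`. -/
def besselSeries (ν : ℝ) : PowerSeries ℝ := PowerSeries.mk (besselCoeff ν)

/-- Bessel's equation in the variable `w = z²`, with the factor `z^ν` removed. -/
theorem besselSeries_ode {ν : ℝ} (hν : 0 ≤ ν) :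
    X * derivative ℝ (derivative ℝ (besselSeries ν)) + C (ν + 1) * derivative ℝ (besselSeries ν) +
      C (1 / 4) * besselSeries ν = 0 := by
  ext n
  have key := besselCoeff_succ hν n
  have hX : PowerSeries.coeff n (X * derivative ℝ (derivative ℝ (besselSeries ν))) =
      n * (n + 1) * besselCoeff ν (n + 1) := by
    rcases n with _ | n
    · simp
    · rw [coeff_succ_X_mul, coeff_derivative, coeff_derivative, besselSeries, coeff_mk]
      push_cast; ring
  rw [map_add (PowerSeries.coeff n), map_add (PowerSeries.coeff n), coeff_C_mul, coeff_C_mul, hX,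
    coeff_derivative, map_zero, besselSeries, coeff_mk, coeff_mk]
  linarith

theorem nonnegLog_besselSeries {ν : ℝ} (hν : 0 ≤ ν) : NonnegLog (besselSeries ν) := by
  set J := besselSeries ν with hJ
  have hc : constantCoeff J ≠ 0 := by
    rw [← coeff_zero_eq_constantCoeff_apply, hJ, besselSeries, coeff_mk, besselCoeff_zero hν]
    exact one_ne_zero
  have hJ0 : J ≠ 0 := fun h => hc (by rw [h, map_zero])
  set S := -(derivative ℝ J * J⁻¹) with hS
  have h1 : derivative ℝ J = -(S * J) := by
    have := PowerSeries.inv_mul_cancel J hc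
    rw [hS]
    linear_combination -derivative ℝ J * this
  -- The Riccati equation of the second-order equation for `J`. Comparing coefficients, `(n + ν + 2)
  -- S_{n+1}` is a sum of products of earlier coefficients, so nonnegativity propagates from `S_0 =
  -- 1 / (4 (ν + 1))`.
  have hR : X * derivative ℝ S + C (ν + 1) * S = X * (S * S) + C (1 / 4) := by
    have h2 := besselSeries_ode hν
    rw [← hJ, h1, map_neg, Derivation.leibniz, h1] at h2
    simp only [smul_eq_mul] at h2
    refine mul_right_cancel₀ hJ0 ?_
    linear_combination -h2
  have h0 : (ν + 1) * PowerSeries.coeff 0 S = 1 / 4 := by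
    have := congrArg (PowerSeries.coeff 0) hR
    rw [map_add (PowerSeries.coeff 0), map_add (PowerSeries.coeff 0), coeff_zero_X_mul,
      coeff_zero_X_mul, coeff_C_mul, coeff_zero_C] at this
    linarith
  have hn : ∀ n : ℕ, (n + 1 + (ν + 1)) * PowerSeries.coeff (n + 1) S =
      ∑ p ∈ Finset.HasAntidiagonal.antidiagonal n, PowerSeries.coeff p.1 S * PowerSeries.coeff p.2 S := by
    intro n
    have := congrArg (PowerSeries.coeff (n + 1)) hR
    rw [map_add (PowerSeries.coeff (n + 1)), map_add (PowerSeries.coeff (n + 1)),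
      coeff_succ_X_mul, coeff_succ_X_mul, coeff_C_mul, coeff_C,
      if_neg (by omega), coeff_derivative, coeff_mul] at this
    linarith
  refine ⟨S, h1, fun n => ?_, ?_⟩
  · induction n using Nat.strong_induction_on with
    | _ n ih =>
      rcases n with _ | n
      · refine nonneg_of_mul_nonneg_right (b := PowerSeries.coeff 0 S) (a := ν + 1) ?_ (by positivity)
        rw [h0]; norm_num
      · refine nonneg_of_mul_nonneg_right (a := n + 1 + (ν + 1)) ?_ (by positivity)
        rw [hn]
        refine Finset.sum_nonneg fun p hp => ?_
        have := Finset.HasAntidiagonal.mem_antidiagonal.1 hp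
        exact mul_nonneg (ih _ (by omega)) (ih _ (by omega))
  · refine pos_of_mul_pos_right (a := ν + 1) ?_ (by positivity)
    rw [h0]; norm_num

/-- The Taylor coefficients of `E`. -/
def ECoeff (a b c ν : ℝ) (n : ℕ) : ℝ := Q a b c (2 * n + ν) / Q a b c ν * besselCoeff ν n

/-- With `θ = X d/dX`, the coefficients of `E` come from applying `Q(2θ + ν) / Q(ν)` to the Bessel
series. Bessel's equation says that `4(θ² + νθ)` acts as `-X`, which reduces this to the first-order
operator `2(b - a)θ + Q(ν) - aX`. No real roots of `Q` are needed. -/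
theorem geomLog_of_linear {a b c ν : ℝ} (hν : 0 ≤ ν) (hQ : Q a b c ν ≠ 0) (hb : b - a ≠ 0)
    (hs : 0 < Q a b c ν / (2 * (b - a))) (ht : 0 ≤ a / (2 * (b - a))) :
    GeomLog (PowerSeries.mk (ECoeff a b c ν)) := by
  have h := ((nonnegLog_besselSeries hν).step hs ht).const_mul (2 * (b - a) / Q a b c ν)
  convert h using 1
  ext n
  have hX : PowerSeries.coeff n (X * derivative ℝ (besselSeries ν)) = n * besselCoeff ν n := by
    rcases n with _ | n
    · simp
    · rw [coeff_succ_X_mul, coeff_derivative, besselSeries, coeff_mk]; push_cast; ring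
  have hX2 : PowerSeries.coeff n (X * besselSeries ν) = -(4 * n * (n + ν) * besselCoeff ν n) := by
    rcases n with _ | n
    · simp
    · rw [coeff_succ_X_mul, besselSeries, coeff_mk]
      push_cast
      linarith [besselCoeff_succ hν n]
  rw [coeff_C_mul, map_add, hX, sub_mul, map_sub, mul_assoc, coeff_C_mul, coeff_C_mul, hX2,
    coeff_mk, besselSeries, coeff_mk, ECoeff]
  field_simp
  simp only [Q]
  ring

/-- Here `Q(2θ + ν) = 4a (θ + (ν - x)/2)(θ + (ν - y)/2)` with `θ = X d/dX`, so `NonnegLog.step`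
applies twice with `t = 0`. Both shifts are positive, since `ν` is at least each root and is not
itself a root. -/
theorem geomLog_of_roots {a b c ν : ℝ} (hν : 0 ≤ ν) (hQ : Q a b c ν ≠ 0) {x y : ℝ}
    (hxy : ∀ z, Q a b c z = a * (z - x) * (z - y)) (hx : x ≤ ν) (hy : y ≤ ν) :
    GeomLog (PowerSeries.mk (ECoeff a b c ν)) := by
  have hQ' := hQ
  rw [hxy] at hQ'
  have hx' : 0 < (ν - x) / 2 := by
    rcases hx.eq_or_lt with h | h
    · simp [h] at hQ'
    · linarith
  have hy' : 0 < (ν - y) / 2 := by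
    rcases hy.eq_or_lt with h | h
    · simp [h] at hQ'
    · linarith
  have h := ((((nonnegLog_besselSeries hν).step hx' le_rfl).nonnegLog).step hy' le_rfl).const_mul
    (4 * a / Q a b c ν)
  convert h using 1
  ext n
  have hX : ∀ F : PowerSeries ℝ, PowerSeries.coeff n (X * derivative ℝ F) = n * PowerSeries.coeff n F := by
    intro F
    rcases n with _ | n
    · simp
    · rw [coeff_succ_X_mul, coeff_derivative]; push_cast; ring
  have hC : ∀ (r : ℝ) (F : PowerSeries ℝ), PowerSeries.coeff n
      (X * derivative ℝ F + (C r - C 0 * X) * F) = (n + r) * PowerSeries.coeff n F := by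
    intro r F
    rw [map_zero, zero_mul, sub_zero, map_add, hX, coeff_C_mul]
    ring
  rw [coeff_C_mul, hC, hC, coeff_mk, besselSeries, coeff_mk, ECoeff, hxy (2 * n + ν)]
  ring

/-- The factorization is used whenever real roots are guaranteed: for `c = 0`, `a ≠ 0` the roots are
`0` and `(a - b)/a`, and for `a < 0 < c` the discriminant is positive. In the remaining cases the
first-order reduction has the right signs. -/
theorem geomLog_ECoeff {a b c ν : ℝ} (habc : (c = 0 ∧ a ≠ b) ∨ (0 < c ∧ a < b)) (hν : 0 ≤ ν)
    (hν₀ : ∀ x : ℝ, Q a b c x = 0 → x ≤ ν) (hQ : Q a b c ν ≠ 0) :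
    GeomLog (PowerSeries.mk (ECoeff a b c ν)) := by
  rcases habc with ⟨rfl, hab⟩ | ⟨hc, hab⟩
  · have h0 : Q a b 0 0 = 0 := by simp [Q]
    rcases eq_or_ne a 0 with rfl | ha
    · have hb : b ≠ 0 := hab.symm
      have hν0 : ν ≠ 0 := by rintro rfl; exact hQ h0
      have hν1 : 0 < ν := lt_of_le_of_ne hν hν0.symm
      refine geomLog_of_linear hν hQ (by simpa using hb) ?_ (by simp)
      have : Q 0 b 0 ν / (2 * (b - 0)) = ν / 2 := by simp only [Q]; field_simp; ring
      rw [this]; positivity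
    · have hfac : ∀ z, Q a b 0 z = a * (z - 0) * (z - (a - b) / a) := by
        intro z; simp only [Q]; field_simp; ring
      exact geomLog_of_roots hν hQ hfac hν (hν₀ _ (by rw [hfac]; ring))
  · rcases le_or_gt 0 a with ha | ha
    · have hb : 0 < b - a := by linarith
      have hQp : 0 < Q a b c ν := by
        have : Q a b c ν = a * ν ^ 2 + (b - a) * ν + c := by simp only [Q]; ring
        rw [this]; positivity
      exact geomLog_of_linear hν hQ hb.ne' (by positivity) (by positivity)
    · set d := Real.sqrt ((b - a) ^ 2 - 4 * a * c) with hd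
      have hd2 : d ^ 2 = (b - a) ^ 2 - 4 * a * c := Real.sq_sqrt (by nlinarith [sq_nonneg (b - a)])
      have ha' : a ≠ 0 := ha.ne
      have hfac : ∀ z, Q a b c z =
          a * (z - (-(b - a) + d) / (2 * a)) * (z - (-(b - a) - d) / (2 * a)) := by
        intro z
        simp only [Q]
        field_simp
        linear_combination hd2
      exact geomLog_of_roots hν hQ hfac (hν₀ _ (by rw [hfac]; ring)) (hν₀ _ (by rw [hfac]; ring))

end MaMindaBessel

/-! ### Analytic consequences: convergence on zero-free disks and the first zero. -/

namespace MaMindaBessel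

section PowerSeriesFacts

variable {a b : ℕ → ℂ} {f g : ℂ → ℂ} {R : ℝ}

theorem summable_norm_of_hasSum_ball (hf : ∀ z ∈ ball (0 : ℂ) R, HasSum (fun n => a n * z ^ n) (f z))
    {r : ℝ} (h0 : 0 ≤ r) (hr : r < R) : Summable fun n => ‖a n‖ * r ^ n := by
  have hm : (r : ℂ) ∈ ball (0 : ℂ) R := by
    rw [mem_ball_zero_iff, Complex.norm_real, Real.norm_eq_abs, abs_of_nonneg h0]; exact hr
  refine (hf _ hm).summable.norm.congr fun n => ?_
  rw [norm_mul, norm_pow, Complex.norm_real, Real.norm_eq_abs, abs_of_nonneg h0]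

theorem differentiableOn_and_hasSum_deriv
    (hf : ∀ z ∈ ball (0 : ℂ) R, HasSum (fun n => a n * z ^ n) (f z)) :
    DifferentiableOn ℂ f (ball 0 R) ∧
      ∀ z ∈ ball (0 : ℂ) R, HasSum (fun n : ℕ => a (n + 1) * ((n + 1) * z ^ n)) (deriv f z) := by
  have hmain : ∀ z ∈ ball (0 : ℂ) R, DifferentiableAt ℂ f z ∧
      HasSum (fun n : ℕ => a (n + 1) * ((n + 1) * z ^ n)) (deriv f z) := by
    intro z hz
    have hz' := mem_ball_zero_iff.1 hz
    obtain ⟨r, hzr, hrR⟩ := exists_between hz'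
    have hr0 : 0 ≤ r := (norm_nonneg z).trans hzr.le
    have hu := summable_norm_of_hasSum_ball hf hr0 hrR
    have hle : ∀ n, ∀ w ∈ ball (0 : ℂ) r, ‖a n * w ^ n‖ ≤ ‖a n‖ * r ^ n := by
      intro n w hw
      rw [norm_mul, norm_pow]
      have := (mem_ball_zero_iff.1 hw).le
      gcongr
    have hd : ∀ n, ∀ w : ℂ, HasDerivAt (fun w => a n * w ^ n) (a n * (n * w ^ (n - 1))) w :=
      fun n w => (_root_.hasDerivAt_pow n w).const_mul (a n)
    have hzr' : z ∈ ball (0 : ℂ) r := mem_ball_zero_iff.2 hzr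
    have hev : f =ᶠ[𝓝 z] fun w => ∑' n, a n * w ^ n := by
      filter_upwards [isOpen_ball.mem_nhds hzr'] with w hw
      exact (hf w (ball_subset_ball hrR.le hw)).tsum_eq.symm
    have h1 := Complex.differentiableOn_tsum_of_summable_norm (F := fun n w => a n * w ^ n) hu
      (fun n w _ => (hd n w).differentiableAt.differentiableWithinAt) isOpen_ball hle
    have h2 := Complex.hasSum_deriv_of_summable_norm (F := fun n w => a n * w ^ n) hu
      (fun n w _ => (hd n w).differentiableAt.differentiableWithinAt) isOpen_ball hle hzr'
    refine ⟨(h1.differentiableAt (isOpen_ball.mem_nhds hzr')).congr_of_eventuallyEq hev, ?_⟩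
    rw [hev.deriv_eq]
    have h3 : HasSum (fun n : ℕ => a n * (n * z ^ (n - 1))) (deriv (fun w => ∑' n, a n * w ^ n) z) :=
      h2.congr_fun fun n => (hd n z).deriv.symm
    have h4 := (hasSum_nat_add_iff' 1).2 h3
    simpa using h4
  exact ⟨fun z hz => (hmain z hz).1.differentiableWithinAt, fun z hz => (hmain z hz).2⟩

theorem coeff_eq_of_hasSum_ball (hR : 0 < R)
    (hf : ∀ z ∈ ball (0 : ℂ) R, HasSum (fun n => a n * z ^ n) (f z))
    (hg : ∀ z ∈ ball (0 : ℂ) R, HasSum (fun n => b n * z ^ n) (f z)) : a = b := by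
  have key : ∀ c : ℕ → ℂ, (∀ z ∈ ball (0 : ℂ) R, HasSum (fun n => c n * z ^ n) (f z)) →
      HasFPowerSeriesAt f (FormalMultilinearSeries.ofScalars ℂ c) 0 := by
    intro c hc
    rw [hasFPowerSeriesAt_iff]
    filter_upwards [isOpen_ball.mem_nhds (mem_ball_self hR)] with z hz
    rw [zero_add]
    refine (hc z hz).congr_fun fun n => ?_
    rw [FormalMultilinearSeries.coeff_ofScalars, smul_eq_mul, mul_comm]
  have h := (key a hf).eq_formalMultilinearSeries (key b hg)
  funext n
  have := congrArg (fun p => p.coeff n) h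
  simpa [FormalMultilinearSeries.coeff_ofScalars] using this

theorem hasSum_cauchyProduct (hf : ∀ z ∈ ball (0 : ℂ) R, HasSum (fun n => a n * z ^ n) (f z))
    (hg : ∀ z ∈ ball (0 : ℂ) R, HasSum (fun n => b n * z ^ n) (g z)) :
    ∀ z ∈ ball (0 : ℂ) R, HasSum (fun n => PowerSeries.coeff n
      (PowerSeries.mk a * PowerSeries.mk b) * z ^ n) (f z * g z) := by
  intro z hz
  have h1 := (hf z hz).summable.norm
  have h2 := (hg z hz).summable.norm
  have h3 := tsum_mul_tsum_eq_tsum_sum_antidiagonal_of_summable_norm h1 h2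
  have h4 := (summable_norm_sum_mul_antidiagonal_of_summable_norm h1 h2).of_norm
  rw [(hf z hz).tsum_eq, (hg z hz).tsum_eq] at h3
  rw [h3]
  refine h4.hasSum.congr_fun fun n => ?_
  rw [PowerSeries.coeff_mul, Finset.sum_mul]
  refine Finset.sum_congr rfl fun p hp => ?_
  rw [PowerSeries.coeff_mk, PowerSeries.coeff_mk, ← Finset.HasAntidiagonal.mem_antidiagonal.1 hp,
    pow_add]
  ring

end PowerSeriesFacts

section LogDeriv

variable {F S : PowerSeries ℝ} {E : ℂ → ℂ}

/-- Transfers the formal series `S` to the function. On a zero-free disk `-E'/E` is holomorphic, so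
its Taylor series converges there; multiplied by `F` it gives `-F'`, as does `S`, and `F ≠ 0` can be
cancelled. -/
theorem hasSum_neg_logDeriv (hFS : PowerSeries.derivative ℝ F = -(S * F)) (hE0 : E 0 = 1)
    (hE : ∀ z, HasSum (fun n => ((PowerSeries.coeff n F : ℝ) : ℂ) * z ^ n) (E z)) {R : ℝ} (hR : 0 < R)
    (hne : ∀ z ∈ ball (0 : ℂ) R, E z ≠ 0) {z : ℂ} (hz : z ∈ ball (0 : ℂ) R) :
    HasSum (fun n => ((PowerSeries.coeff n S : ℝ) : ℂ) * z ^ n) (-deriv E z / E z) := by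
  obtain ⟨hd, hder⟩ := differentiableOn_and_hasSum_deriv (R := R) (fun z _ => hE z)
  have hT : DifferentiableOn ℂ (fun z => -deriv E z / E z) (ball 0 R) :=
    (hd.deriv isOpen_ball).neg.div hd hne
  have htay : ∀ z ∈ ball (0 : ℂ) R, HasSum (fun n : ℕ =>
      ((n.factorial : ℂ)⁻¹ * iteratedDeriv n (fun z => -deriv E z / E z) 0) * z ^ n)
      (-deriv E z / E z) := by
    intro z hz
    refine (Complex.hasSum_taylorSeries_on_ball hT hz).congr_fun fun n => ?_
    simp only [sub_zero, smul_eq_mul]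
    ring
  set p : ℕ → ℂ := fun n : ℕ =>
      (n.factorial : ℂ)⁻¹ * iteratedDeriv n (fun z => -deriv E z / E z) 0 with hp
  set Fc : PowerSeries ℂ := PowerSeries.map Complex.ofRealHom F with hFc
  set Sc : PowerSeries ℂ := PowerSeries.map Complex.ofRealHom S with hSc
  have hmkF : PowerSeries.mk (fun n => ((PowerSeries.coeff n F : ℝ) : ℂ)) = Fc := by
    ext n; simp [hFc]
  have h1 := hasSum_cauchyProduct htay (fun z _ => hE z)
  have h2 : ∀ z ∈ ball (0 : ℂ) R, HasSum (fun n =>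
      PowerSeries.coeff n (-PowerSeries.derivative ℂ Fc) * z ^ n) (-deriv E z / E z * E z) := by
    intro z hz
    rw [div_mul_cancel₀ _ (hne z hz)]
    refine (hder z hz).neg.congr_fun fun n => ?_
    rw [map_neg, PowerSeries.coeff_derivative, hFc, PowerSeries.coeff_map]
    simp only [Complex.ofRealHom_eq_coe]
    ring
  have h3 := coeff_eq_of_hasSum_ball hR h1 h2
  have h4 : PowerSeries.mk p * Fc = -PowerSeries.derivative ℂ Fc := by
    ext n; rw [← hmkF]; simpa [hmkF] using congrFun h3 n
  have h5 : PowerSeries.derivative ℂ Fc = -(Sc * Fc) := by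
    have : PowerSeries.derivative ℂ Fc =
        PowerSeries.map Complex.ofRealHom (PowerSeries.derivative ℝ F) := by
      ext n
      rw [PowerSeries.coeff_map, PowerSeries.coeff_derivative, PowerSeries.coeff_derivative, hFc,
        PowerSeries.coeff_map]
      simp
    rw [this, hFS, map_neg, map_mul]
  have hF0 : ((PowerSeries.coeff 0 F : ℝ) : ℂ) = 1 := by
    have h := (hE 0).unique (hasSum_single 0 fun n hn => by simp [hn])
    rw [hE0] at h
    simpa using h.symm
  have hFc0 : Fc ≠ 0 := by
    intro h
    have := congrArg (PowerSeries.coeff 0) h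
    rw [hFc, PowerSeries.coeff_map, map_zero] at this
    simp only [Complex.ofRealHom_eq_coe, hF0] at this
    exact one_ne_zero this
  have h6 : PowerSeries.mk p = Sc := by
    refine mul_right_cancel₀ hFc0 ?_
    rw [h4, h5, neg_neg]
  refine (htay z hz).congr_fun fun n => ?_
  have := congrArg (PowerSeries.coeff n) h6
  rw [PowerSeries.coeff_mk, hSc, PowerSeries.coeff_map, Complex.ofRealHom_eq_coe] at this
  rw [← this]

/-- If `-E'/E` has nonnegative Taylor coefficients on a zero-free disk, then
`|E z| ≥ |E |z||` there. -/
theorem norm_apply_norm_le {τ : ℕ → ℝ} (hτ : ∀ n, 0 ≤ τ n) {R : ℝ}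
    (hd : DifferentiableOn ℂ E (ball 0 R)) (hE0 : E 0 = 1) (hne : ∀ z ∈ ball (0 : ℂ) R, E z ≠ 0)
    (hT : ∀ z ∈ ball (0 : ℂ) R, HasSum (fun n => (τ n : ℂ) * z ^ n) (-deriv E z / E z))
    {z : ℂ} (hz : z ∈ ball (0 : ℂ) R) : ‖E (‖z‖ : ℂ)‖ ≤ ‖E z‖ := by
  have hsum : ∀ z ∈ ball (0 : ℂ) R, Summable fun n : ℕ => τ n / (n + 1) * ‖z‖ ^ (n + 1) := by
    intro z hz
    have h1 := summable_norm_of_hasSum_ball hT (norm_nonneg z) (mem_ball_zero_iff.1 hz)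
    refine Summable.of_nonneg_of_le (fun n => ?_) (fun n => ?_) (h1.mul_left ‖z‖)
    · have := hτ n; positivity
    · rw [Complex.norm_real, Real.norm_eq_abs, abs_of_nonneg (hτ n)]
      have h2 : τ n / (n + 1) ≤ τ n := div_le_self (hτ n) (by linarith [Nat.cast_nonneg (α := ℝ) n])
      calc τ n / (n + 1) * ‖z‖ ^ (n + 1) ≤ τ n * ‖z‖ ^ (n + 1) := by gcongr
        _ = _ := by ring
  -- Coefficients of the primitive `L` of `-E'/E`. At `n = 0` division by zero yields `0`, which is
  -- the normalization `L 0 = 0` giving `E = exp (-L)`.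
  set l : ℕ → ℂ := fun n => ((τ (n - 1) / n : ℝ) : ℂ) with hl
  have hl1 : ∀ n : ℕ, l (n + 1) = ((τ n / (n + 1) : ℝ) : ℂ) := fun n => by simp [hl]
  set L : ℂ → ℂ := fun z => ∑' n, l n * z ^ n with hL
  have hLsum : ∀ z ∈ ball (0 : ℂ) R, HasSum (fun n => l n * z ^ n) (L z) := by
    intro z hz
    refine Summable.hasSum ((summable_nat_add_iff 1).1 (Summable.of_norm ((hsum z hz).congr ?_)))
    intro n
    rw [hl1, norm_mul, norm_pow, Complex.norm_real, Real.norm_eq_abs, abs_of_nonneg]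
    have := hτ n; positivity
  obtain ⟨hLd, hLder⟩ := differentiableOn_and_hasSum_deriv hLsum
  have hLT : ∀ z ∈ ball (0 : ℂ) R, deriv L z = -deriv E z / E z := by
    intro z hz
    refine (hLder z hz).unique ((hT z hz).congr_fun fun n => ?_)
    rw [hl1]
    push_cast
    have : (n : ℂ) + 1 ≠ 0 := by exact_mod_cast n.succ_ne_zero
    field_simp
  have hL0 : L 0 = 0 := by
    have h0 : l 0 = 0 := by simp [hl]
    rw [hL]
    simp only
    rw [tsum_eq_single 0 fun n hn => by simp [hn], h0, zero_mul]
  have hR : 0 < R := pos_of_mem_ball hz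
  have key : ∀ w ∈ ball (0 : ℂ) R, E w = Complex.exp (-L w) := by
    have hk : ∀ w ∈ ball (0 : ℂ) R, HasDerivAt (fun w => E w * Complex.exp (L w)) 0 w := by
      intro w hw
      have h1 := (hd.differentiableAt (isOpen_ball.mem_nhds hw)).hasDerivAt
      have h2 := (hLd.differentiableAt (isOpen_ball.mem_nhds hw)).hasDerivAt
      refine (h1.mul h2.cexp).congr_deriv ?_
      rw [hLT w hw]
      have := hne w hw
      field_simp
      ring
    intro w hw
    have := isOpen_ball.is_const_of_deriv_eq_zero (convex_ball (0 : ℂ) R).isPreconnected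
      (fun w hw => (hk w hw).differentiableAt.differentiableWithinAt)
      (fun w hw => (hk w hw).deriv) hw (mem_ball_self hR)
    simp only [hL0, hE0, Complex.exp_zero, mul_one] at this
    rw [Complex.exp_neg]
    exact eq_inv_of_mul_eq_one_left this
  have hz' : (‖z‖ : ℂ) ∈ ball (0 : ℂ) R := by
    rw [mem_ball_zero_iff, Complex.norm_real, norm_norm]; exact mem_ball_zero_iff.1 hz
  rw [key z hz, key _ hz', Complex.norm_exp, Complex.norm_exp, Complex.neg_re, Complex.neg_re,
    Real.exp_le_exp, neg_le_neg_iff]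
  have e1 := Complex.hasSum_re (hLsum z hz)
  have e2 := Complex.hasSum_re (hLsum _ hz')
  -- As `|E| = exp (-Re L)`, it suffices that `Re L(z) ≤ L(|z|)`, which holds termwise by
  -- nonnegativity of the coefficients.
  refine hasSum_le (fun n => ?_) e1 e2
  have hln : 0 ≤ τ (n - 1) / n := div_nonneg (hτ _) (by positivity)
  simp only [hl]
  rw [Complex.re_ofReal_mul, Complex.re_ofReal_mul, ← Complex.ofReal_pow, Complex.ofReal_re]
  refine mul_le_mul_of_nonneg_left ?_ hln
  rw [← norm_pow]
  exact Complex.re_le_norm _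

/-- An entire function whose negative logarithmic derivative has coefficients bounded below by a
geometric sequence has a zero, and a zero of smallest modulus lies on the positive axis. -/
theorem exists_first_zero {v : ℝ} (hFS : PowerSeries.derivative ℝ F = -(S * F)) (hE0 : E 0 = 1)
    (hE : ∀ z, HasSum (fun n => ((PowerSeries.coeff n F : ℝ) : ℂ) * z ^ n) (E z))
    (hv : 0 < v) (hS : ∀ n, v ^ (n + 1) ≤ PowerSeries.coeff n S) :
    ∃ Λ : ℝ, 0 < Λ ∧ E Λ = 0 ∧ ∀ z ∈ ball (0 : ℂ) Λ, E z ≠ 0 := by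
  have hd : Differentiable ℂ E := fun z =>
    (differentiableOn_and_hasSum_deriv (R := ‖z‖ + 1) fun z _ => hE z).1.differentiableAt
      (isOpen_ball.mem_nhds (by simp))
  have hex : ∃ z, E z = 0 := by
    by_contra! hno
    have hv' : ((v⁻¹ : ℝ) : ℂ) ∈ ball (0 : ℂ) (v⁻¹ + 1) := by
      rw [mem_ball_zero_iff, Complex.norm_real, Real.norm_eq_abs, abs_of_pos (by positivity)]
      linarith
    have h1 := hasSum_neg_logDeriv hFS hE0 hE (R := v⁻¹ + 1) (by positivity) (fun z _ => hno z) hv'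
    have h2 := h1.summable.norm.tendsto_atTop_zero
    -- Without zeros the series of `-E'/E` would converge at `1/v`, but the geometric bound keeps
    -- its terms there at least `v`.
    have h3 : ∀ n, v ≤ ‖((PowerSeries.coeff n S : ℝ) : ℂ) * ((v⁻¹ : ℝ) : ℂ) ^ n‖ := by
      intro n
      rw [norm_mul, norm_pow, Complex.norm_real, Complex.norm_real, Real.norm_eq_abs,
        Real.norm_eq_abs, abs_of_pos (by positivity : 0 < v⁻¹), abs_of_nonneg
        ((by positivity : 0 ≤ v ^ (n + 1)).trans (hS n))]
      calc v = v ^ (n + 1) * v⁻¹ ^ n := by rw [pow_succ, inv_pow]; field_simp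
        _ ≤ _ := by gcongr; exact hS n
    have := ge_of_tendsto' h2 h3
    linarith
  have hcl : IsClosed {z | E z = 0} := isClosed_eq hd.continuous continuous_const
  obtain ⟨w, hw, hmin⟩ := hcl.exists_infDist_eq_dist (x := 0) hex
  have hw0 : E w = 0 := hw
  have hpos : 0 < ‖w‖ := by
    rw [norm_pos_iff]; rintro rfl; rw [hE0] at hw0; exact one_ne_zero hw0
  have hne : ∀ z ∈ ball (0 : ℂ) ‖w‖, E z ≠ 0 := by
    intro z hz h
    have h1 := infDist_le_dist_of_mem (x := 0) (show z ∈ {z | E z = 0} from h)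
    rw [hmin, dist_zero_left, dist_zero_left] at h1
    exact absurd (mem_ball_zero_iff.1 hz) (not_lt.2 h1)
  refine ⟨‖w‖, hpos, ?_, hne⟩
  have hT := fun z hz => hasSum_neg_logDeriv hFS hE0 hE hpos hne (z := z) hz
  -- Letting `t → 1` moves the zero `w` of least modulus to the positive point `‖w‖`.
  have hle : ∀ t ∈ Ico (0 : ℝ) 1, ‖E ((t * ‖w‖ : ℝ) : ℂ)‖ ≤ ‖E (t * w)‖ := by
    intro t ht
    have hn : ‖(t : ℂ) * w‖ = t * ‖w‖ := by
      rw [norm_mul, Complex.norm_real, Real.norm_eq_abs, abs_of_nonneg ht.1]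
    have := norm_apply_norm_le (fun n => (by positivity : 0 ≤ v ^ (n + 1)).trans (hS n))
      hd.differentiableOn hE0 hne hT (z := t * w)
      (by rw [mem_ball_zero_iff, hn]; nlinarith [ht.2])
    rwa [hn] at this
  have hc1 : Continuous fun t : ℝ => ‖E ((t * ‖w‖ : ℝ) : ℂ)‖ :=
    (hd.continuous.comp (by fun_prop)).norm
  have hc2 : Continuous fun t : ℝ => ‖E (t * w)‖ := (hd.continuous.comp (by fun_prop)).norm
  have hcl2 : IsClosed {t : ℝ | ‖E ((t * ‖w‖ : ℝ) : ℂ)‖ ≤ ‖E (t * w)‖} := isClosed_le hc1 hc2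
  have h1 : (1 : ℝ) ∈ closure (Ico (0 : ℝ) 1) := by
    rw [closure_Ico zero_ne_one]; exact ⟨zero_le_one, le_rfl⟩
  have h2 := hcl2.closure_subset_iff.2 hle h1
  simp only [mem_ofPred_eq, one_mul, Complex.ofReal_one, hw0, norm_zero] at h2
  exact norm_le_zero_iff.1 h2

end LogDeriv

end MaMindaBessel

/-! ### Majorization by the positive axis and the convexity radius. -/

namespace MaMindaBessel

/-- `S` and `w ↦ w S'(w)` are dominated on the disk of radius `Λ` by their restrictions `s`, `d`
to the positive axis, which increase, and `s` is unbounded. -/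
structure IsMajorized (S : ℂ → ℂ) (Λ : ℝ) (s d : ℝ → ℝ) : Prop where
  differentiableOn : DifferentiableOn ℂ S (ball 0 Λ)
  ofReal : ∀ x ∈ Ico 0 Λ, S x = s x
  ofReal_deriv : ∀ x ∈ Ico 0 Λ, (x : ℂ) * deriv S x = d x
  norm_le : ∀ w ∈ ball (0 : ℂ) Λ, ‖S w‖ ≤ s ‖w‖
  norm_deriv_le : ∀ w ∈ ball (0 : ℂ) Λ, ‖w * deriv S w‖ ≤ d ‖w‖
  strictMonoOn : StrictMonoOn s (Ico 0 Λ)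
  monotoneOn : MonotoneOn d (Ico 0 Λ)
  continuousOn : ContinuousOn s (Ico 0 Λ)
  continuousOn_deriv : ContinuousOn d (Ico 0 Λ)
  zero : s 0 = 0
  deriv_zero : d 0 = 0
  le_deriv : ∀ x ∈ Ico 0 Λ, s x ≤ d x
  unbounded : ∀ M, ∃ x ∈ Ico 0 Λ, M < s x

theorem isMajorized_of_hasSum {τ : ℕ → ℝ} (hτ : ∀ n, 0 ≤ τ n) (hτ0 : 0 < τ 0) {Λ : ℝ} (hΛ : 0 < Λ)
    {E : ℂ → ℂ} (hE : Differentiable ℂ E) (hEΛ : E Λ = 0)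
    (hne : ∀ z ∈ ball (0 : ℂ) Λ, E z ≠ 0)
    (hT : ∀ z ∈ ball (0 : ℂ) Λ, HasSum (fun n => (τ n : ℂ) * z ^ n) (-deriv E z / E z)) :
    IsMajorized (fun z => -(z * deriv E z / E z)) Λ (fun x => ∑' n : ℕ, τ n * x ^ (n + 1))
      (fun x => ∑' n : ℕ, (n + 1) * τ n * x ^ (n + 1)) := by
  set S : ℂ → ℂ := fun z => -(z * deriv E z / E z) with hSdef
  have hmem : ∀ x ∈ Ico 0 Λ, (x : ℂ) ∈ ball (0 : ℂ) Λ := by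
    intro x hx
    rw [mem_ball_zero_iff, Complex.norm_real, Real.norm_eq_abs, abs_of_nonneg hx.1]
    exact hx.2
  have hS : ∀ z ∈ ball (0 : ℂ) Λ, HasSum (fun n : ℕ => (τ n : ℂ) * z ^ (n + 1)) (S z) := by
    intro z hz
    have h := (hT z hz).mul_left z
    rw [hSdef]
    have e : z * (-deriv E z / E z) = -(z * deriv E z / E z) := by ring
    rw [e] at h
    exact h.congr_fun fun n => by ring
  set t : ℕ → ℂ := fun n => if n = 0 then 0 else (τ (n - 1) : ℂ) with ht
  have hS' : ∀ z ∈ ball (0 : ℂ) Λ, HasSum (fun n : ℕ => t n * z ^ n) (S z) := by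
    intro z hz
    refine (hasSum_nat_add_iff' 1).1 ?_
    simpa [ht] using hS z hz
  obtain ⟨hSd, hSder⟩ := differentiableOn_and_hasSum_deriv hS'
  have hD : ∀ z ∈ ball (0 : ℂ) Λ,
      HasSum (fun n : ℕ => (((n + 1) * τ n : ℝ) : ℂ) * z ^ (n + 1)) (z * deriv S z) := by
    intro z hz
    refine ((hSder z hz).mul_left z).congr_fun fun n => ?_
    simp [ht]
    ring
  have hsR : ∀ x ∈ Ico 0 Λ, Summable fun n : ℕ => τ n * x ^ (n + 1) := by
    intro x hx
    refine Complex.summable_ofReal.1 ((hS x (hmem x hx)).summable.congr fun n => ?_)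
    push_cast; rfl
  have hdR : ∀ x ∈ Ico 0 Λ, Summable fun n : ℕ => (n + 1) * τ n * x ^ (n + 1) := by
    intro x hx
    refine Complex.summable_ofReal.1 ((hD x (hmem x hx)).summable.congr fun n => ?_)
    push_cast; rfl
  have hnorm : ∀ z ∈ ball (0 : ℂ) Λ, ‖z‖ ∈ Ico 0 Λ := fun z hz =>
    ⟨norm_nonneg z, mem_ball_zero_iff.1 hz⟩
  have hofReal : ∀ x ∈ Ico 0 Λ, S x = ((∑' n : ℕ, τ n * x ^ (n + 1) : ℝ) : ℂ) := by
    intro x hx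
    rw [← (hS x (hmem x hx)).tsum_eq, Complex.ofReal_tsum]
    push_cast; rfl
  have hofReal' : ∀ x ∈ Ico 0 Λ,
      (x : ℂ) * deriv S x = ((∑' n : ℕ, (n + 1) * τ n * x ^ (n + 1) : ℝ) : ℂ) := by
    intro x hx
    rw [← (hD x (hmem x hx)).tsum_eq, Complex.ofReal_tsum]
    push_cast; rfl
  have hcast : ContinuousOn (fun x : ℝ => (x : ℂ)) (Ico 0 Λ) := by fun_prop
  have hmono : StrictMonoOn (fun x => ∑' n : ℕ, τ n * x ^ (n + 1)) (Ico 0 Λ) := by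
    intro x hx y hy hxy
    refine Summable.tsum_lt_tsum (i := 0) (fun n => ?_) ?_ (hsR x hx) (hsR y hy)
    · have := hx.1
      have := hτ n
      gcongr
    · simp only [zero_add, pow_one]
      gcongr
  refine ⟨hSd, hofReal, hofReal', fun w hw => ?_, fun w hw => ?_, hmono, ?_, ?_, ?_, by simp,
    by simp, ?_, ?_⟩
  · refine (hS w hw).norm_le_of_bounded (hsR _ (hnorm w hw)).hasSum fun n => ?_
    rw [norm_mul, norm_pow, Complex.norm_real, Real.norm_eq_abs, abs_of_nonneg (hτ n)]
  · refine (hD w hw).norm_le_of_bounded (hdR _ (hnorm w hw)).hasSum fun n => ?_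
    have := hτ n
    rw [norm_mul, norm_pow, Complex.norm_real, Real.norm_eq_abs, abs_of_nonneg (by positivity)]
  · intro x hx y hy hxy
    refine (hdR x hx).tsum_le_tsum (fun n => ?_) (hdR y hy)
    have := hx.1
    have := hτ n
    gcongr
  · refine ContinuousOn.congr (f := fun x : ℝ => (S x).re) ?_ fun x hx => ?_
    · exact Complex.continuous_re.comp_continuousOn (hSd.continuousOn.comp hcast hmem)
    · simp only [hofReal x hx, Complex.ofReal_re]
  · refine ContinuousOn.congr (f := fun x : ℝ => ((x : ℂ) * deriv S x).re) ?_ fun x hx => ?_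
    · exact Complex.continuous_re.comp_continuousOn
        (hcast.mul ((hSd.deriv isOpen_ball).continuousOn.comp hcast hmem))
    · simp only [hofReal' x hx, Complex.ofReal_re]
  · intro x hx
    refine (hsR x hx).tsum_le_tsum (fun n => ?_) (hdR x hx)
    have := hx.1
    have := hτ n
    have h1 : τ n ≤ (n + 1) * τ n := by nlinarith [Nat.cast_nonneg (α := ℝ) n]
    gcongr
  -- If `s` were bounded, then `|E'| ≤ K |E|` on `[Λ/2, Λ]`, and a Grönwall argument run backwards
  -- from `E(Λ) = 0` would make `E` vanish at `Λ/2`, inside the zero-free disk.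
  · intro M
    by_contra! hM
    have hM0 : 0 ≤ M := by simpa using hM 0 ⟨le_rfl, hΛ⟩
    set K := M / (Λ / 2) with hK
    have hE'c : Continuous (deriv E) :=
      continuousOn_univ.1 ((hE.differentiableOn (s := univ)).deriv isOpen_univ).continuousOn
    have hle : ∀ x ∈ Ico (Λ / 2) Λ, ‖deriv E x‖ ≤ K * ‖E x‖ := by
      intro x hx
      have hx0 : 0 < x := by linarith [hx.1]
      have hxI : x ∈ Ico 0 Λ := ⟨hx0.le, hx.2⟩
      have hEx := hne _ (hmem x hxI)
      have h1 : ‖S x‖ ≤ M := by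
        rw [hofReal x hxI, Complex.norm_real, Real.norm_eq_abs, abs_of_nonneg]
        · exact hM x hxI
        · exact tsum_nonneg fun n => mul_nonneg (hτ n) (by positivity)
      rw [hSdef] at h1
      simp only [norm_neg, norm_div, norm_mul, Complex.norm_real, Real.norm_eq_abs,
        abs_of_pos hx0] at h1
      rw [div_le_iff₀ (norm_pos_iff.2 hEx)] at h1
      rw [hK, div_mul_eq_mul_div, le_div_iff₀ (by positivity)]
      calc ‖deriv E x‖ * (Λ / 2) ≤ ‖deriv E x‖ * x := by gcongr; exact hx.1
        _ ≤ _ := by linarith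
    have hle' : ∀ x ∈ Icc (Λ / 2) Λ, ‖deriv E x‖ ≤ K * ‖E x‖ := by
      have hcl : IsClosed {x : ℝ | ‖deriv E x‖ ≤ K * ‖E x‖} :=
        isClosed_le (hE'c.comp Complex.continuous_ofReal).norm
          (continuous_const.mul (hE.continuous.comp Complex.continuous_ofReal).norm)
      have := hcl.closure_subset_iff.2 hle
      rwa [closure_Ico (by linarith)] at this
    have hg : ∀ t : ℝ, HasDerivAt (fun t : ℝ => E ((Λ - t : ℝ) : ℂ)) (-deriv E ((Λ - t : ℝ) : ℂ)) t := by
      intro t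
      have h1 : HasDerivAt (fun t : ℝ => ((Λ - t : ℝ) : ℂ)) (-1) t := by
        simpa using ((hasDerivAt_id t).const_sub Λ).ofReal_comp
      exact ((hE _).hasDerivAt.comp t h1).congr_deriv (by ring)
    have := eq_zero_of_abs_deriv_le_mul_abs_self_of_eq_zero_right
      (f := fun t : ℝ => E ((Λ - t : ℝ) : ℂ)) (f' := fun t : ℝ => -deriv E ((Λ - t : ℝ) : ℂ))
      (K := K) (a := 0) (b := Λ / 2) (fun t _ => (hg t).continuousAt.continuousWithinAt)
      (fun t _ => (hg t).hasDerivWithinAt) (by simp [hEΛ])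
      (fun t ht => by
        rw [norm_neg]
        exact hle' _ ⟨by linarith [ht.2], by linarith [ht.1]⟩)
      (Λ / 2) ⟨by positivity, le_rfl⟩
    exact hne _ (hmem (Λ - Λ / 2) ⟨by linarith, by linarith⟩) this

/-- The common core of the three cases. From `f = z q` one gets `f' = q (1 - A S)` and `z f''/f' =
-(A S + p A D / (1 - A S))`, with `S` and `D = w S'(w)` taken at `w = z^p`. The triangle inequality
bounds the modulus by the same expression in `s`, `d` at `|z|^p`, with equality on the positive
axis. -/
theorem exists_convexRadius {S : ℂ → ℂ} {Λ : ℝ} {s d : ℝ → ℝ} (h : IsMajorized S Λ s d)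
    (hΛ : 0 < Λ) {A : ℝ} (hA : 0 < A) {p : ℕ} (hp : p ≠ 0) {q f : ℂ → ℂ}
    (hqd : ∀ z : ℂ, ‖z‖ ^ p < Λ → DifferentiableAt ℂ q z)
    (hq0 : ∀ z : ℂ, ‖z‖ ^ p < Λ → q z ≠ 0)
    (hq : ∀ z : ℂ, ‖z‖ ^ p < Λ → z * deriv q z = -(A * S (z ^ p) * q z))
    (hf : ∀ z, f z = z * q z) {φ : ℂ → ℂ} {β : ℝ} (hβ : 0 < β)
    (hball : ball (1 : ℂ) β ⊆ φ '' ball 0 1) (hβ' : 1 - (β : ℂ) ∉ φ '' ball 0 1) :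
    ∃ R : ℝ, IsLeast {r : ℝ | 0 < r ∧
      (r : ℂ) * deriv (deriv f) (r : ℂ) + (β : ℂ) * deriv f (r : ℂ) = 0} R ∧
      R ^ p < Λ ∧ IsConvexRadius φ f R := by
  have hopen : IsOpen {z : ℂ | ‖z‖ ^ p < Λ} := isOpen_lt (by fun_prop) continuous_const
  have hball0 : ∀ z : ℂ, ‖z‖ ^ p < Λ → z ^ p ∈ ball (0 : ℂ) Λ := fun z hz => by
    rwa [mem_ball_zero_iff, norm_pow]
  have hd1 : ∀ z : ℂ, ‖z‖ ^ p < Λ → deriv f z = q z * (1 - A * S (z ^ p)) := by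
    intro z hz
    have e : f = fun z => z * q z := funext hf
    have h1 : deriv f z = 1 * q z + z * deriv q z := by
      rw [e]
      exact ((hasDerivAt_id z).mul (hqd z hz).hasDerivAt).deriv
    rw [h1]
    linear_combination hq z hz
  have hd2 : ∀ z : ℂ, ‖z‖ ^ p < Λ → z * deriv (deriv f) z =
      -(q z * (A * S (z ^ p) * (1 - A * S (z ^ p)) + p * A * (z ^ p * deriv S (z ^ p)))) := by
    intro z hz
    have hev : deriv f =ᶠ[𝓝 z] fun z => q z * (1 - A * S (z ^ p)) := by
      filter_upwards [hopen.mem_nhds hz] with w hw using hd1 w hw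
    have hSd := (h.differentiableOn.differentiableAt
      (isOpen_ball.mem_nhds (hball0 z hz))).hasDerivAt
    have hcomp : HasDerivAt (fun z => S (z ^ p)) (deriv S (z ^ p) * (p * z ^ (p - 1))) z :=
      HasDerivAt.comp z hSd (_root_.hasDerivAt_pow p z)
    have h1 : deriv (fun z => q z * (1 - A * S (z ^ p))) z =
        deriv q z * (1 - A * S (z ^ p)) + q z * -(A * (deriv S (z ^ p) * (p * z ^ (p - 1)))) :=
      ((hqd z hz).hasDerivAt.mul ((hcomp.const_mul (A : ℂ)).const_sub 1)).deriv
    rw [hev.deriv_eq, h1]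
    have hzp : z ^ p = z * z ^ (p - 1) := (mul_pow_sub_one hp z).symm
    linear_combination (1 - A * S (z ^ p)) * hq z hz +
      (p * A * q z * deriv S (z ^ p)) * hzp
  -- The inequality `A s + p A d / (1 - A s) < β` with its denominator cleared. On the positive
  -- axis, `r f'' + β f' = q(r) ψ(r^p)`.
  set ψ : ℝ → ℝ := fun x => (β - A * s x) * (1 - A * s x) - p * A * d x with hψ
  have hp' : (0 : ℝ) < p := by positivity
  have h0 : (0 : ℝ) ∈ Ico 0 Λ := ⟨le_rfl, hΛ⟩
  obtain ⟨x₁, hx₁, hs₁⟩ := h.unbounded (1 / A)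
  have hsub : ∀ {y}, y ∈ Ico 0 Λ → Icc 0 y ⊆ Ico 0 Λ := fun hy x hx => ⟨hx.1, hx.2.trans_lt hy.2⟩
  -- At `ρ` the factor `1 - A s` of `f'` vanishes. There `ψ < 0`, while `ψ(0) = β > 0`, so `ψ` has a
  -- root before `ρ`.
  obtain ⟨ρ, hρ, hsρ⟩ := intermediate_value_Icc hx₁.1 (h.continuousOn.mono (hsub hx₁))
    (show 1 / A ∈ Icc (s 0) (s x₁) from ⟨by rw [h.zero]; positivity, hs₁.le⟩)
  have hρΛ := hsub hx₁ hρ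
  have hAρ : A * s ρ = 1 := by rw [hsρ]; field_simp
  have hψρ : ψ ρ < 0 := by
    have : 0 < d ρ := by
      have := h.le_deriv ρ hρΛ
      rw [hsρ] at this
      exact (by positivity : 0 < 1 / A).trans_le this
    simp only [hψ, hAρ]
    have : 0 < p * A * d ρ := by positivity
    linarith
  have hψ0 : ψ 0 = β := by simp [hψ, h.zero, h.deriv_zero]
  have hψc : ContinuousOn ψ (Icc 0 ρ) := by
    have c1 := h.continuousOn.mono (hsub hρΛ)
    have c2 := h.continuousOn_deriv.mono (hsub hρΛ)
    exact ((continuousOn_const.sub (continuousOn_const.mul c1)).mul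
      (continuousOn_const.sub (continuousOn_const.mul c1))).sub (continuousOn_const.mul c2)
  obtain ⟨x₀, hx₀, hψx₀⟩ := intermediate_value_Icc' hρ.1 hψc
    (show (0 : ℝ) ∈ Icc (ψ ρ) (ψ 0) from ⟨hψρ.le, by rw [hψ0]; exact hβ.le⟩)
  have hx₀0 : 0 < x₀ := lt_of_le_of_ne hx₀.1 (by rintro rfl; linarith)
  have hx₀ρ : x₀ < ρ := lt_of_le_of_ne hx₀.2 (by rintro rfl; linarith)
  have hx₀Λ := hsub hρΛ hx₀
  have hA₀ : A * s x₀ < 1 := by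
    rw [← hAρ]
    exact mul_lt_mul_of_pos_left (h.strictMonoOn hx₀Λ hρΛ hx₀ρ) hA
  have hd₀ : 0 ≤ d x₀ := by
    rw [← h.deriv_zero]; exact h.monotoneOn h0 hx₀Λ hx₀0.le
  -- With both factors of the product nonnegative at `x₀`, they are larger at every earlier point,
  -- while `d` is no larger there. Thus `ψ > 0` on `[0, x₀)`, and `x₀` is the first root.
  have hβ₀ : 0 ≤ β - A * s x₀ := by
    have e : (β - A * s x₀) * (1 - A * s x₀) = p * A * d x₀ := by
      simp only [hψ] at hψx₀; linarith
    refine nonneg_of_mul_nonneg_left (b := 1 - A * s x₀) ?_ (by linarith)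
    rw [e]; positivity
  have hlt : ∀ x, 0 ≤ x → x < x₀ → A * s x < 1 ∧ 0 < ψ x := by
    intro x hx hxx
    have hxΛ : x ∈ Ico 0 Λ := ⟨hx, hxx.trans hx₀Λ.2⟩
    have h1 : A * s x < A * s x₀ := mul_lt_mul_of_pos_left (h.strictMonoOn hxΛ hx₀Λ hxx) hA
    have h2 : p * A * d x ≤ p * A * d x₀ :=
      mul_le_mul_of_nonneg_left (h.monotoneOn hxΛ hx₀Λ hxx.le) (by positivity)
    refine ⟨h1.trans hA₀, ?_⟩
    have h3 : (β - A * s x₀) * (1 - A * s x₀) < (β - A * s x) * (1 - A * s x) := by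
      have : 0 < A * s x₀ - A * s x := by linarith
      nlinarith
    simp only [hψ] at hψx₀ ⊢
    linarith
  set R : ℝ := x₀ ^ (1 / (p : ℝ)) with hR
  have hRp : R ^ p = x₀ := by
    rw [hR, one_div, Real.rpow_inv_natCast_pow hx₀0.le hp]
  have hR0 : 0 < R := Real.rpow_pos_of_pos hx₀0 _
  have hroot : ∀ r : ℝ, 0 ≤ r → r ^ p < Λ → (r : ℂ) * deriv (deriv f) r + β * deriv f r =
      q r * ψ (r ^ p) := by
    intro r hr hrp
    have hn : ‖(r : ℂ)‖ ^ p < Λ := by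
      rwa [Complex.norm_real, Real.norm_eq_abs, abs_of_nonneg hr]
    have hI : r ^ p ∈ Ico 0 Λ := ⟨by positivity, hrp⟩
    have e1 := h.ofReal _ hI
    have e2 := h.ofReal_deriv _ hI
    push_cast at e1 e2
    rw [hd2 r hn, hd1 r hn, e1, e2, hψ]
    push_cast
    ring
  have hRn : ‖(R : ℂ)‖ ^ p < Λ := by
    rw [Complex.norm_real, Real.norm_eq_abs, abs_of_pos hR0, hRp]; exact hx₀Λ.2
  have hR2 : (R : ℂ) * deriv (deriv f) R + β * deriv f R = 0 := by
    rw [hroot R hR0.le (by rw [hRp]; exact hx₀Λ.2), hRp, hψx₀, Complex.ofReal_zero, mul_zero]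
  refine ⟨R, ⟨⟨hR0, hR2⟩, ?_⟩, by rw [hRp]; exact hx₀Λ.2, ?_⟩
  · rintro r ⟨hr0, hr⟩
    by_contra! hlt'
    have hrp : r ^ p < x₀ := by rw [← hRp]; exact pow_lt_pow_left₀ hlt' hr0.le hp
    have hn : ‖(r : ℂ)‖ ^ p < Λ := by
      rw [Complex.norm_real, Real.norm_eq_abs, abs_of_pos hr0]; exact hrp.trans hx₀Λ.2
    rw [hroot r hr0.le (hrp.trans hx₀Λ.2)] at hr
    rcases mul_eq_zero.1 hr with h1 | h1
    · exact hq0 _ hn h1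
    · exact (hlt _ (by positivity) hrp).2.ne' (by exact_mod_cast h1)
  · have hmem : R ∈ convexRadii φ f := by
      refine ⟨hR0, fun z hz => ?_⟩
      have hzx : ‖z‖ ^ p < x₀ := by
        rw [← hRp]; exact pow_lt_pow_left₀ (mem_ball_zero_iff.1 hz) (norm_nonneg z) hp
      have hzΛ := hzx.trans hx₀Λ.2
      obtain ⟨hA1, hψ1⟩ := hlt _ (by positivity) hzx
      have hb := hball0 z hzΛ
      have n1 := h.norm_le _ hb
      have n2 := h.norm_deriv_le _ hb
      rw [norm_pow] at n1 n2
      set D : ℂ := z ^ p * deriv S (z ^ p) with hD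
      have nA : ‖(A : ℂ) * S (z ^ p)‖ ≤ A * s (‖z‖ ^ p) := by
        rw [norm_mul, Complex.norm_real, Real.norm_eq_abs, abs_of_pos hA]
        gcongr
      have nU : 1 - A * s (‖z‖ ^ p) ≤ ‖1 - (A : ℂ) * S (z ^ p)‖ := by
        have := norm_sub_norm_le (1 : ℂ) (A * S (z ^ p))
        rw [norm_one] at this
        linarith
      have hU : 1 - (A : ℂ) * S (z ^ p) ≠ 0 := by
        rw [← norm_pos_iff]; linarith
      have hqz := hq0 z hzΛ
      have hne : deriv f z ≠ 0 := by rw [hd1 z hzΛ]; exact mul_ne_zero hqz hU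
      refine ⟨hne, hball ?_⟩
      have e : z * deriv (deriv f) z / deriv f z =
          -(A * S (z ^ p) + p * A * D / (1 - A * S (z ^ p))) := by
        rw [hd2 z hzΛ, hd1 z hzΛ, ← hD]
        clear_value D
        field_simp
      rw [mem_ball, dist_eq_norm, add_sub_cancel_left, e, norm_neg]
      have hpos : 0 < 1 - A * s (‖z‖ ^ p) := by linarith
      calc ‖(A : ℂ) * S (z ^ p) + p * A * D / (1 - A * S (z ^ p))‖
          ≤ ‖(A : ℂ) * S (z ^ p)‖ + ‖(p : ℂ) * A * D / (1 - A * S (z ^ p))‖ := norm_add_le _ _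
        _ ≤ A * s (‖z‖ ^ p) + p * A * d (‖z‖ ^ p) / (1 - A * s (‖z‖ ^ p)) := by
          have hpA : ‖(p : ℂ) * A * D‖ = p * A * ‖D‖ := by
            rw [norm_mul, norm_mul, Complex.norm_natCast, Complex.norm_real, Real.norm_eq_abs,
              abs_of_pos hA]
          rw [norm_div, hpA]
          have hdn : 0 ≤ d (‖z‖ ^ p) := (norm_nonneg _).trans n2
          gcongr
        _ < β := by
          rw [← lt_sub_iff_add_lt', div_lt_iff₀ hpos]
          simp only [hψ] at hψ1
          linarith
    refine ⟨⟨R, hmem⟩, IsGreatest.isLUB ⟨hmem, ?_⟩⟩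
    -- Any larger disk contains the point `R` itself, where `1 + z f''/f'` takes the omitted value
    -- `1 - β`.
    rintro r ⟨hr0, hr⟩
    by_contra! hlt'
    obtain ⟨hne, hin⟩ := hr R (by
      rw [mem_ball_zero_iff, Complex.norm_real, Real.norm_eq_abs, abs_of_pos hR0]; exact hlt')
    refine hβ' ?_
    have e : (R : ℂ) * deriv (deriv f) R / deriv f R = -β := by
      rw [div_eq_iff hne]; linear_combination hR2
    rwa [e, ← sub_eq_add_neg] at hin

end MaMindaBessel

/-! ### The boundary point of `φ(𝔻)` and the specialization to Bessel functions. -/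

namespace MaMindaBessel

theorem IsMaMinda.isOpen_image {φ : ℂ → ℂ} (hφ : IsMaMinda φ) {s : Set ℂ} (hs : s ⊆ ball 0 1)
    (hso : IsOpen s) : IsOpen (φ '' s) := by
  have h0 : (0 : ℂ) ∈ ball (0 : ℂ) 1 := mem_ball_self one_pos
  have h1 : (1 / 2 : ℂ) ∈ ball (0 : ℂ) 1 := by simp; norm_num
  have han : AnalyticOnNhd ℂ φ (ball 0 1) := hφ.differentiableOn.analyticOnNhd isOpen_ball
  rcases han.is_constant_or_isOpen (convex_ball 0 1).isPreconnected with ⟨w, hw⟩ | h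
  · have := hφ.injOn h1 h0 (by rw [hw _ h1, hw _ h0])
    norm_num at this
  · exact h s hs hso

/-- If `w = φ(z₀)` with `|z₀| < r < 1`, the open set `φ(|z| < r)` contains `φ(x)` for `x` near `-1`;
but `|x| > r`, contradicting injectivity. -/
theorem boundary_value_notMem {φ : ℂ → ℂ} (hφ : IsMaMinda φ) {w : ℂ}
    (h : Tendsto (fun x : ℝ => φ (x : ℂ)) (𝓝[>] (-1)) (𝓝 w)) : w ∉ φ '' ball 0 1 := by
  rintro ⟨z₀, hz₀, rfl⟩
  have hn : ‖z₀‖ < 1 := mem_ball_zero_iff.1 hz₀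
  obtain ⟨r, hzr, hr⟩ := exists_between hn
  have hsub : ball (0 : ℂ) r ⊆ ball 0 1 := ball_subset_ball hr.le
  have hnhds : φ '' ball 0 r ∈ 𝓝 (φ z₀) :=
    (hφ.isOpen_image hsub isOpen_ball).mem_nhds ⟨z₀, mem_ball_zero_iff.2 hzr, rfl⟩
  have h1 : ∀ᶠ x : ℝ in 𝓝[>] (-1), x ∈ Ioo (-1 : ℝ) (-r) :=
    Ioo_mem_nhdsGT (by linarith)
  have hr0 : 0 ≤ r := (norm_nonneg _).trans hzr.le
  obtain ⟨x, hx1, hx2⟩ := ((h.eventually hnhds).and h1).exists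
  obtain ⟨y, hy, hyx⟩ := hx1
  have habs : ‖(x : ℂ)‖ = -x := by
    rw [Complex.norm_real, Real.norm_eq_abs, abs_of_neg (by linarith [hx2.2])]
  have hxm : (x : ℂ) ∈ ball (0 : ℂ) 1 := by
    rw [mem_ball_zero_iff, habs]; linarith [hx2.1]
  have := hφ.injOn (hsub hy) hxm hyx
  rw [this, mem_ball_zero_iff, habs] at hy
  linarith [hx2.2]

theorem radius_pos {φ : ℂ → ℂ} (hφ : IsMaMinda φ) {β : ℝ}
    (hβ : IsGreatest {ρ : ℝ | ball (1 : ℂ) ρ ⊆ φ '' ball 0 1} β) : 0 < β := by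
  obtain ⟨ε, hε, hsub⟩ := Metric.isOpen_iff.1
    (hφ.isOpen_image Subset.rfl isOpen_ball) 1 ⟨0, mem_ball_self one_pos, hφ.map_zero⟩
  exact hε.trans_le (hβ.2 hsub)

theorem hasSum_ECoeff {a b c ν : ℝ} (hν : 0 ≤ ν) (hQ : Q a b c ν ≠ 0) (w : ℂ) :
    HasSum (fun n => ((PowerSeries.coeff n (PowerSeries.mk (ECoeff a b c ν)) : ℝ) : ℂ) * w ^ n)
      (E a b c ν w) := by
  -- Convergence is known for arguments `z²`, and every complex number is a square.
  obtain ⟨z, hz⟩ := IsAlgClosed.exists_pow_nat_eq w two_pos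
  have h := hasSum_E (a := a) (b := b) (c := c) hν hQ z
  rw [← E_sq hν hQ, hz] at h
  refine h.congr_fun fun n => ?_
  rw [PowerSeries.coeff_mk, ECoeff, besselCoeff]
  push_cast
  rw [div_pow]
  have hG : (Real.Gamma (n + ν + 1) : ℂ) ≠ 0 := by
    exact_mod_cast (Real.Gamma_pos_of_pos (by positivity : 0 < (n : ℝ) + ν + 1)).ne'
  have hn : (n.factorial : ℂ) ≠ 0 := by exact_mod_cast n.factorial_ne_zero
  have hQ' : (Q a b c ν : ℂ) ≠ 0 := by exact_mod_cast hQ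
  field_simp

theorem besselN_eq_zero_iff {a b c ν : ℝ} (hν : 0 ≤ ν) (hQ : Q a b c ν ≠ 0) {x : ℝ} (hx : 0 < x) :
    besselN a b c ν x = 0 ↔ E a b c ν ((x : ℂ) ^ 2) = 0 := by
  have hs : (x : ℂ) ∈ Complex.slitPlane := Complex.ofReal_mem_slitPlane.2 hx
  have h := besselN_eq hν hQ hs
  have h1 : ((2 ^ ν * Real.Gamma (ν + 1) / Q a b c ν : ℝ) : ℂ) ≠ 0 := by
    have hG := Real.Gamma_pos_of_pos (by positivity : 0 < ν + 1)
    exact_mod_cast div_ne_zero (by positivity) hQ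
  have h2 : (x : ℂ) ^ (ν : ℂ) ≠ 0 := by
    simp [Complex.cpow_eq_zero_iff, hx.ne']
  constructor
  · intro h3
    rw [h3, mul_zero] at h
    exact (mul_eq_zero.1 h.symm).resolve_left h2
  · intro h3
    rw [h3, mul_zero] at h
    exact (mul_eq_zero.1 h).resolve_left h1

theorem hasDerivAt_comp_sq {g : ℂ → ℂ} (hg : Differentiable ℂ g) (z : ℂ) :
    HasDerivAt (fun z => g (z ^ 2)) (deriv g (z ^ 2) * (2 * z)) z :=
  (HasDerivAt.comp z (hg (z ^ 2)).hasDerivAt (_root_.hasDerivAt_pow 2 z)).congr_deriv (by simp)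

/-- Obtained by differentiating `exp (logE z) = E(z²)`. It gives `z q'/q = -(2/ν) S(z²)` for the
factor `q = f_ν(z)/z`. -/
theorem z_mul_deriv_logE {a b c ν : ℝ} (hν : 0 ≤ ν) (hQ : Q a b c ν ≠ 0)
    (hE : Differentiable ℂ (E a b c ν)) {ρ : ℝ}
    (h : ∀ z ∈ ball (0 : ℂ) ρ, E a b c ν (z ^ 2) ≠ 0) {z : ℂ} (hz : z ∈ ball (0 : ℂ) ρ) :
    z * deriv (logE a b c ν) z = 2 * (z ^ 2 * deriv (E a b c ν) (z ^ 2) / E a b c ν (z ^ 2)) := by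
  obtain ⟨h1, h2⟩ := exp_logE hν hQ h
  have hd := (h1.differentiableAt (isOpen_ball.mem_nhds hz)).hasDerivAt
  have hev : (fun z => Complex.exp (logE a b c ν z)) =ᶠ[𝓝 z] fun z => E a b c ν (z ^ 2) := by
    filter_upwards [isOpen_ball.mem_nhds hz] with w hw using h2 w hw
  have e1 := hd.cexp.congr_of_eventuallyEq hev.symm
  have e3 := e1.unique (hasDerivAt_comp_sq hE z)
  rw [h2 z hz] at e3
  have hne := h z hz
  field_simp
  linear_combination z * e3

end MaMindaBessel

open MaMindaBessel

theorem theorem4 (a b c ν : ℝ)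
    -- standing assumption on the coefficients
    (habc : (c = 0 ∧ a ≠ b) ∨ (0 < c ∧ a < b))
    -- `ν ≥ max {0, ν₀}`, with `ν₀` the largest real root of `Q` (if there is one)
    (hν : 0 ≤ ν) (hν₀ : ∀ x : ℝ, MaMindaBessel.Q a b c x = 0 → x ≤ ν)
    -- the normalizing factor `2^ν Γ(ν+1) / Q(ν)` is defined
    (hQ : MaMindaBessel.Q a b c ν ≠ 0)
    (φ : ℂ → ℂ) (hφ : MaMindaBessel.IsMaMinda φ) (β : ℝ)
    -- `φ(-1) = 1 - β`, as a radial boundary value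
    (hφ1 : Filter.Tendsto (fun x : ℝ => φ (x : ℂ)) (nhdsWithin (-1) (Set.Ioi (-1)))
      (nhds (1 - (β : ℂ))))
    -- `{w : |w - 1| < β}` is the largest such disk in `φ(𝔻)`
    (hβ : IsGreatest {ρ : ℝ | Metric.ball (1 : ℂ) ρ ⊆ φ '' Metric.ball 0 1} β) :
    ∃ lam : ℝ, IsLeast {x : ℝ | 0 < x ∧ MaMindaBessel.besselN a b c ν (x : ℂ) = 0} lam ∧
      (ν ≠ 0 → ∃ R : ℝ,
        IsLeast {r : ℝ | 0 < r ∧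
          (r : ℂ) * deriv (deriv (MaMindaBessel.fFun a b c ν)) (r : ℂ) +
            (β : ℂ) * deriv (MaMindaBessel.fFun a b c ν) (r : ℂ) = 0} R ∧
        R < lam ∧
        MaMindaBessel.IsConvexRadius φ (MaMindaBessel.fFun a b c ν) R) ∧
      (∃ R : ℝ,
        IsLeast {r : ℝ | 0 < r ∧
          (r : ℂ) * deriv (deriv (MaMindaBessel.gFun a b c ν)) (r : ℂ) +
            (β : ℂ) * deriv (MaMindaBessel.gFun a b c ν) (r : ℂ) = 0} R ∧
        R < lam ∧
        MaMindaBessel.IsConvexRadius φ (MaMindaBessel.gFun a b c ν) R) ∧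
      (∃ R : ℝ,
        IsLeast {r : ℝ | 0 < r ∧
          (r : ℂ) * deriv (deriv (MaMindaBessel.hFun a b c ν)) (r : ℂ) +
            (β : ℂ) * deriv (MaMindaBessel.hFun a b c ν) (r : ℂ) = 0} R ∧
        R < lam ^ 2 ∧
        MaMindaBessel.IsConvexRadius φ (MaMindaBessel.hFun a b c ν) R) := by
  have hβ0 : 0 < β := radius_pos hφ hβ
  have hβ' : 1 - (β : ℂ) ∉ φ '' ball 0 1 := boundary_value_notMem hφ hφ1
  obtain ⟨T, v, hFT, hv, hT⟩ := geomLog_ECoeff habc hν hν₀ hQ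
  have hE0 : E a b c ν 0 = 1 := E_zero hν hQ
  have hsum := hasSum_ECoeff (a := a) (b := b) (c := c) hν hQ
  have hE : Differentiable ℂ (E a b c ν) := fun z =>
    (differentiableOn_and_hasSum_deriv (R := ‖z‖ + 1) fun z _ => hsum z).1.differentiableAt
      (isOpen_ball.mem_nhds (by simp))
  obtain ⟨Λ, hΛ, hEΛ, hne⟩ := exists_first_zero hFT hE0 hsum hv hT
  have hTpos : ∀ n, 0 < PowerSeries.coeff n T := fun n =>
    (by positivity : 0 < v ^ (n + 1)).trans_le (hT n)
  have hmaj := isMajorized_of_hasSum (fun n => (hTpos n).le) (hTpos 0) hΛ hE hEΛ hne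
    fun z hz => hasSum_neg_logDeriv hFT hE0 hsum hΛ hne hz
  have hsqrt : 0 < √Λ := Real.sqrt_pos.2 hΛ
  have hsq : √Λ ^ 2 = Λ := Real.sq_sqrt hΛ.le
  have hne2 : ∀ z : ℂ, ‖z‖ ^ 2 < Λ → E a b c ν (z ^ 2) ≠ 0 := fun z hz =>
    hne _ (by rwa [mem_ball_zero_iff, norm_pow])
  have hlt : ∀ {R : ℝ}, R ^ 2 < Λ → R < √Λ := fun h => Real.lt_sqrt_of_sq_lt h
  -- For `x > 0`, `N_ν(x)` vanishes exactly when `E(x²)` does, so the first zero `Λ` of `E`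
  -- corresponds to `√Λ`.
  refine ⟨√Λ, ⟨⟨hsqrt, ?_⟩, ?_⟩, fun hν1 => ?_, ?_, ?_⟩
  · rw [besselN_eq_zero_iff hν hQ hsqrt, ← Complex.ofReal_pow, hsq]
    exact hEΛ
  · rintro x ⟨hx0, hx⟩
    rw [besselN_eq_zero_iff hν hQ hx0] at hx
    by_contra! hlt
    refine hne2 x ?_ hx
    rw [Complex.norm_real, Real.norm_eq_abs, abs_of_pos hx0, ← hsq]
    gcongr
  · have hνp : 0 < ν := lt_of_le_of_ne hν hν1.symm
    have hνc : (ν : ℂ) ≠ 0 := by exact_mod_cast hν1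
    have hball : ∀ z : ℂ, ‖z‖ ^ 2 < Λ → z ∈ ball (0 : ℂ) (√Λ) := fun z hz =>
      mem_ball_zero_iff.2 (hlt hz)
    have hne3 : ∀ z ∈ ball (0 : ℂ) (√Λ), E a b c ν (z ^ 2) ≠ 0 := fun z hz => by
      refine hne2 z ?_
      rw [← hsq]
      have := mem_ball_zero_iff.1 hz
      gcongr
    have hlog : ∀ z : ℂ, ‖z‖ ^ 2 < Λ → DifferentiableAt ℂ (logE a b c ν) z := fun z hz =>
      (exp_logE hν hQ hne3).1.differentiableAt (isOpen_ball.mem_nhds (hball z hz))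
    -- The `2` comes from differentiating `E(z²)`, the `1/ν` from the root.
    obtain ⟨R, h1, h2, h3⟩ := exists_convexRadius hmaj hΛ (A := 2 / ν) (by positivity)
      (p := 2) two_ne_zero (q := fun z => Complex.exp (logE a b c ν z / ν)) (f := fFun a b c ν)
      (fun z hz => ((hlog z hz).div_const _).cexp) (fun z _ => Complex.exp_ne_zero _)
      (fun z hz => by
        rw [((hlog z hz).hasDerivAt.div_const (ν : ℂ)).cexp.deriv]
        have := z_mul_deriv_logE hν hQ hE hne3 (hball z hz)
        push_cast
        linear_combination (Complex.exp (logE a b c ν z / ν) / ν) * this)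
      (fun z => rfl) hβ0 hβ.1 hβ'
    exact ⟨R, h1, hlt h2, h3⟩
  · obtain ⟨R, h1, h2, h3⟩ := exists_convexRadius hmaj hΛ (A := 2) two_pos
      (p := 2) two_ne_zero (q := fun z => E a b c ν (z ^ 2)) (f := gFun a b c ν)
      (fun z _ => (hasDerivAt_comp_sq hE z).differentiableAt) hne2
      (fun z hz => by
        rw [(hasDerivAt_comp_sq hE z).deriv]
        have := hne2 z hz
        push_cast
        field_simp)
      (fun z => rfl) hβ0 hβ.1 hβ'
    exact ⟨R, h1, hlt h2, h3⟩
  · obtain ⟨R, h1, h2, h3⟩ := exists_convexRadius hmaj hΛ (A := 1) one_pos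
      (p := 1) one_ne_zero (q := E a b c ν) (f := hFun a b c ν)
      (fun z _ => hE z) (fun z hz => hne z (by simpa using hz))
      (fun z hz => by
        have := hne z (by simpa using hz)
        rw [pow_one]
        push_cast
        field_simp)
      (fun z => rfl) hβ0 hβ.1 hβ'
    exact ⟨R, h1, by rw [hsq]; simpa using h2, h3⟩
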